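/- **Setting.** Let $\mathcal X=(x_1,\dots,x_m)$ with $x_v\in\mathbb R^{d_v}$, $d=\sum_v d_v$, and let $\mathcal V=\{1,\dots,n\}$ be a set of agents. Agent $i$ is assigned a subset $\mathcal X_i$ of the variables, with $\bigcup_i\mathcal X_i=\mathcal X$; write $\mathcal X_{ij}=\mathcal X_i\cap\mathcal X_j$ and $\mathfrak d_i$ for the dimension of $\mathcal X_i$. Let $\mathcal F_k$ be the set of probability densities on $\mathbb R^k$ with respect to Lebesgue measure. Each agent has a jointly measurable likelihood $q_i(z\mid\mathcal X_i)$ with $q_i(\cdot\mid\mathcal X_i)\in\mathcal F_{\ell_i}$; put $q(z\mid\mathcal X)=\prod_i q_i(z_i\mid\mathcal X_i)$, and let $\mathcal X^\star$ be the true parameter, $q_i^\star=q_i(\cdot\mid\mathcal X_i^\star)$, $q^\star=q(\cdot\mid\mathcal X^\star)$. Let $$\mathcal F^\star=\arg\min_{p\in\mathcal F_d}\ \mathbb E_{\mathcal X\sim p}\big[\mathrm{KL}[q^\star,q(\cdot\mid\mathcal X)]\big],$$ and assume that $\mathcal F^\star\neq\emptyset$ and that the minimal value is $0$, the value at $\mathcal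 X^\star$. For $p\in\mathcal F_d$ let $p_i$ be its marginal over $\mathcal X_i$. **Assumptions.** 1. The measurements $z_{i,t}$ ($i\in\mathcal V$, $t\ge0$) are independent across time and agents, and $z_{i,t}$ has density $q_i^\star$. 2. $A\in\mathbb R^{n\times n}$ is nonnegative, symmetric, with $A\mathbf 1=\mathbf 1$ and $A_{ii}>0$; the digraph $\mathcal G$ with edges $\{(i,j):A_{ij}>0\}$ is connected. 3. There is $L$ such that $q_i(z\mid\mathcal X_i)>0$ and $|\log q_i(z\mid\mathcal X_i)|\le L$ for all $i$, all $\mathcal X_i$, and all $z$ with $q_i^\star(z)>0$. 4. $\alpha_t>0$, $\sum_t\alpha_t=\infty$, $\sum_t\alpha_t^2<\infty$. 5. The priors $p_{i,0}\in\mathcal F_{\mathfrak d_i}$ are strictly positive everywhere. 6. For every variable, the agents whose $\mathcal X_i$ contains it induce a connected subgraph of $\mathcal G$. **Algorithm.** For $t\ge0$, with $p_{ij,t}$ the marginal of $p_{i,t}$ over $\mathcal X_{ij}$ and $p_{ji,t}$ the marginal of $p_{j,t}$ over $\mathcal X_{ij}$, $$v_{i,t}=\frac1{Z^v_{i,t}}\prod_{j}\Big(\frac{p_{i,t}(\mathcal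 X_i)}{p_{ij,t}(\mathcal X_{ij})}\,p_{ji,t}(\mathcal X_{ij})\Big)^{A_{ij}},\qquad Z^v_{i,t}=\int\prod_{j}\Big(\frac{p_{i,t}(\mathcal X_i)}{p_{ij,t}(\mathcal X_{ij})}\,p_{ji,t}(\mathcal X_{ij})\Big)^{A_{ij}}d\mathcal X_i ,$$ $$p_{i,t+1}\in\arg\min_{p\in\mathcal F_{\mathfrak d_i}}\Big\{\alpha_t\big\langle-\log q_i(z_{i,t}\mid\cdot),p\big\rangle+\mathrm{KL}[p,v_{i,t}]\Big\}.$$ **Conjectured contraction (assumed).** There are constants $\sigma\in(0,1)$ and $c>1$ such that, almost surely, there exist joint densities $\bar p_t\in\mathcal F_d$, with marginals $\bar p_{i,t}$ over $\mathcal X_i$, satisfying for all $i$ and $t$ $$\|v_{i,t}-\bar p_{i,t}\|_{TV}\le\sigma\,\|p_{i,t}-\bar p_{i,t}\|_{TV},\qquad \|\bar p_t-\bar p_{t+1}\|_{TV}\le (c-1)\,\alpha_t L/2 .$$ **Conclusion.** Almost surely, for every agent $i$ and every $\varepsilon>0$, there is $t_0$ such that for all $t\ge t_0$ the mixed marginal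 $v_{i,t}$ belongs to $$\mathcal B_i(\mathcal F^\star,\varepsilon)=\Big\{g\in\mathcal F_{\mathfrak d_i}:\ \exists\,p^\star\in\mathcal F^\star,\ \mathrm{KL}[p^\star_i,g]\le\varepsilon\Big\}.$$ -/

import Mathlib

open MeasureTheory ProbabilityTheory Filter
open scoped ENNReal Topology

noncomputable section

namespace DMSMD

/-! ### Probability densities, Kullback-Leibler divergence, total variation -/

/-- The space of pdfs: integrable, pointwise nonnegative, with integral one. -/
def IsPdf {E : Type*} [MeasureSpace E] (p : E → ℝ) : Prop :=
  Integrable p ∧ ∫ x, p x = 1 ∧ ∀ x, 0 ≤ p x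

/-- The measure with density `p` with respect to Lebesgue measure. -/
def pdfMeasure {E : Type*} [MeasureSpace E] (p : E → ℝ) : Measure E :=
  volume.withDensity (fun x => ENNReal.ofReal (p x))

/-- `KL[p, g] = ∫ p log (p / g)`, with values in `[0, ∞]`. -/
def KL {E : Type*} [MeasureSpace E] (p g : E → ℝ) : ℝ≥0∞ :=
  InformationTheory.klDiv (pdfMeasure p) (pdfMeasure g)

/-- Total variation distance of two pdfs, `sup_B |∫_B p - ∫_B g|` over measurable sets `B`. -/
def tvDist {E : Type*} [MeasureSpace E] (p g : E → ℝ) : ℝ :=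
  ⨆ B : {B : Set E // MeasurableSet B}, |(∫ x in B.1, p x) - ∫ x in B.1, g x|

/-! ### Vectors of variables, restriction and marginals -/

/-- Values of the variables with index in `s`, the variable `v` having dimension `d v`.
Its `volume` is Lebesgue measure on the product of the spaces `ℝ ^ (d v)`, `v ∈ s`. -/
abbrev Vars {m : ℕ} (d : Fin m → ℕ) (s : Finset (Fin m)) : Type :=
  (v : s) → Fin (d v.1) → ℝ

/-- Restriction of the variables in `s` to those in a subset `t`. -/
def restrictVars {m : ℕ} {d : Fin m → ℕ} {s t : Finset (Fin m)} (h : t ⊆ s)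
    (x : Vars d s) : Vars d t :=
  fun v => x ⟨v.1, h v.2⟩

/-- The vector of the variables in `s` that is `y` on `t` and `w` on `s \ t`. -/
def glueVars {m : ℕ} {d : Fin m → ℕ} {s t : Finset (Fin m)}
    (y : Vars d t) (w : Vars d (s \ t)) : Vars d s :=
  fun v => if h : v.1 ∈ t then y ⟨v.1, h⟩ else w ⟨v.1, Finset.mem_sdiff.mpr ⟨v.2, h⟩⟩

/-- The marginal over the variables in `t ⊆ s` of a function of the variables in `s`:
the variables in `s \ t` are integrated out. -/
def marginal {m : ℕ} {d : Fin m → ℕ} {s : Finset (Fin m)} (t : Finset (Fin m))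
    (p : Vars d s → ℝ) : Vars d t → ℝ :=
  fun y => ∫ w : Vars d (s \ t), p (glueVars y w)

/-! ### The estimation objective and its minimizers -/

/-- The combined likelihood `q(z | X) = ∏ i, q i (z i | X_i)`. -/
def jointLikelihood {n m : ℕ} {d : Fin m → ℕ} {ℓ : Fin n → ℕ} {S : Fin n → Finset (Fin m)}
    (q : (i : Fin n) → (Fin (ℓ i) → ℝ) → Vars d (S i) → ℝ)
    (X : Vars d Finset.univ) (z : (i : Fin n) → Fin (ℓ i) → ℝ) : ℝ :=
  ∏ i, q i (z i) (restrictVars (Finset.subset_univ (S i)) X)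

/-- The objective `E_{X ∼ p} KL[q(· | X⋆), q(· | X)]`. -/
def objective {n m : ℕ} {d : Fin m → ℕ} {ℓ : Fin n → ℕ} {S : Fin n → Finset (Fin m)}
    (q : (i : Fin n) → (Fin (ℓ i) → ℝ) → Vars d (S i) → ℝ) (Xstar : Vars d Finset.univ)
    (p : Vars d Finset.univ → ℝ) : ℝ≥0∞ :=
  ∫⁻ X, KL (jointLikelihood q Xstar) (jointLikelihood q X) ∂(pdfMeasure p)

/-- The set `F⋆` of the joint pdfs that minimize the objective over all joint pdfs. -/
def optimalSet {n m : ℕ} {d : Fin m → ℕ} {ℓ : Fin n → ℕ} {S : Fin n → Finset (Fin m)}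
    (q : (i : Fin n) → (Fin (ℓ i) → ℝ) → Vars d (S i) → ℝ) (Xstar : Vars d Finset.univ) :
    Set (Vars d Finset.univ → ℝ) :=
  {p | IsPdf p ∧ ∀ p', IsPdf p' → objective q Xstar p ≤ objective q Xstar p'}

/-- The partial neighborhood: the pdfs of the variables in `s` that are within divergence `ε`
of the marginal over `s` of some pdf in `F`. -/
def partialNeighborhood {m : ℕ} {d : Fin m → ℕ} (s : Finset (Fin m))
    (F : Set (Vars d Finset.univ → ℝ)) (ε : ℝ) : Set (Vars d s → ℝ) :=
  {g | IsPdf g ∧ ∃ p ∈ F, KL (marginal s p) g ≤ ENNReal.ofReal ε}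

/-! ### The distributed marginal stochastic mirror descent algorithm -/

/-- The product `p_i(X_i \ X_ij | X_ij) p_ji(X_ij)` of agent `i`'s conditional and agent `j`'s
marginal, where `X_ij` are the variables common to the agents `i` and `j`. -/
def edgeMerge {n m : ℕ} {d : Fin m → ℕ} {S : Fin n → Finset (Fin m)}
    (p : (i : Fin n) → Vars d (S i) → ℝ) (i j : Fin n) (x : Vars d (S i)) : ℝ :=
  p i x / marginal (S i ∩ S j) (p i) (restrictVars Finset.inter_subset_left x)
    * marginal (S i ∩ S j) (p j) (restrictVars Finset.inter_subset_left x)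

/-- The unnormalized geometric average; agents `j` that are not neighbors of `i` have
`A i j = 0` and contribute the factor one. -/
def geomPool {n m : ℕ} {d : Fin m → ℕ} {S : Fin n → Finset (Fin m)}
    (A : Matrix (Fin n) (Fin n) ℝ) (p : (i : Fin n) → Vars d (S i) → ℝ) (i : Fin n)
    (x : Vars d (S i)) : ℝ :=
  ∏ j, edgeMerge p i j x ^ A i j

/-- The mixed pdf `v_i` of agent `i`, computed from the estimates `p` of all agents. -/
def mixed {n m : ℕ} {d : Fin m → ℕ} {S : Fin n → Finset (Fin m)}
    (A : Matrix (Fin n) (Fin n) ℝ) (p : (i : Fin n) → Vars d (S i) → ℝ) (i : Fin n)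
    (x : Vars d (S i)) : ℝ :=
  geomPool A p i x / ∫ y, geomPool A p i y

/-- The mirror descent functional `J[p, v] = a ⟨-log q(· ), p⟩ + KL[p, v]`, where `lik` is the
likelihood of the received measurement as a function of the variables and `a` the step size. -/
def mirrorObjective {E : Type*} [MeasureSpace E] (a : ℝ) (lik v p : E → ℝ) : EReal :=
  ((a * ∫ x, -Real.log (lik x) * p x : ℝ) : EReal) + ((KL p v : ℝ≥0∞) : EReal)

/-- `p` is a sequence of agent estimates generated by the algorithm from the priors `p0`, the
measurements `z` and the step sizes `α`: at each time every agent moves to a minimizer over all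
pdfs of its mirror descent functional at its mixed pdf. -/
def IsGenerated {n m : ℕ} {d : Fin m → ℕ} {ℓ : Fin n → ℕ} {S : Fin n → Finset (Fin m)}
    (A : Matrix (Fin n) (Fin n) ℝ) (q : (i : Fin n) → (Fin (ℓ i) → ℝ) → Vars d (S i) → ℝ)
    (α : ℕ → ℝ) (p0 : (i : Fin n) → Vars d (S i) → ℝ)
    (z : ℕ → (i : Fin n) → Fin (ℓ i) → ℝ)
    (p : ℕ → (i : Fin n) → Vars d (S i) → ℝ) : Prop :=
  p 0 = p0 ∧ ∀ t i, IsPdf (p (t + 1) i) ∧ ∀ g, IsPdf g →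
    mirrorObjective (α t) (q i (z t i)) (mixed A (p t) i) (p (t + 1) i)
      ≤ mirrorObjective (α t) (q i (z t i)) (mixed A (p t) i) g

/-- Total variation contraction of marginal mixing along the estimates `p`, with rate `σ` and
constant `c`: there are joint pdfs `pbar t` such that mixing contracts, by the factor `σ`, the
distance of each agent's estimate to the corresponding marginal of `pbar t`, and such that
`pbar` moves by at most `(c - 1) α_t L / 2` in each step. -/
def MixingContraction {n m : ℕ} {d : Fin m → ℕ} {S : Fin n → Finset (Fin m)}
    (A : Matrix (Fin n) (Fin n) ℝ) (α : ℕ → ℝ) (L σ c : ℝ)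
    (p : ℕ → (i : Fin n) → Vars d (S i) → ℝ) : Prop :=
  ∃ pbar : ℕ → Vars d Finset.univ → ℝ,
    (∀ t, IsPdf (pbar t)) ∧
    (∀ t i, tvDist (mixed A (p t) i) (marginal (S i) (pbar t))
      ≤ σ * tvDist (p t i) (marginal (S i) (pbar t))) ∧
    (∀ t, tvDist (pbar t) (pbar (t + 1)) ≤ (c - 1) * α t * L / 2)

end DMSMD

end

/-!
Only the measurements are random; for a fixed outcome the argument is deterministic.

Conservation law. A mirror step multiplies `v i` by the tempered likelihood and normalizes
(`ae_eq_temperedPosterior`, Gibbs' variational principle). Mixing replaces marginals on the shared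
variables, and since the weights are symmetric and stochastic the replaced marginals cancel in the
product over all agents (`prod_geomPool`). Hence, as functions of all variables `X`,
`∏ i, v i t (X i) = c t * ∏ i, p0 i (X i) * R i t (X i)`, where `R i t` is the product of the
tempered likelihood ratios `(q i (z s) x / q i (z s) x⋆) ^ α s` over `s < t`
(`IsGenerated.exists_prod_mixed_eq`).

The constant `c t` stays bounded. Let `Θ i` be the set of parameters of agent `i` whose likelihood
agrees with the true one. An optimal joint density lives on the `X` with `X i ∈ Θ i` for all `i`,
and there `R i t = 1`. If `c t` were large, some `v i t` would be much larger than `p0 i` on a set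
of substantial probability, which is impossible for densities (`exists_bound_of_prod_eq`).

Single agents. For each agent, `∫_B p0 i * R i t` is, up to a bounded factor that Hoeffding's lemma
provides, a nonnegative supermartingale. So it is almost surely bounded, and for `B` the complement
of `Θ i` it tends to zero, because its mean does: at a parameter `x`, up
to that factor, `R i t` has mean at most `exp (-KL * ∑ α)` with the divergence `KL > 0` of the true
likelihood from the one at `x`, and `∑ α = ∞` (`ae_integral_mul_likelihoodRatio`).

From the product to the factors. The assumed contraction, with steps of vanishing size, shows that
the `v i t` are asymptotically the marginals of joint densities `pbar t`
(`IsGenerated.tendsto_tvDist`). Each `v j t` exceeds a small multiple of `p0 j * R j t` with high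
probability under itself, hence all of them do so simultaneously under `pbar t`; the product formula
then bounds each `v i t` by a multiple of `p0 i * R i t` off a small set
(`measureReal_le_of_prod_eq`). Therefore `v i t` gives vanishing mass to the complement of `Θ i`.

Conclusion. By the union bound `pbar t` concentrates on the `X` with `X i ∈ Θ i` for all `i`, so
`v i t` concentrates on the set `B` of those `x` that extend to such `X` with positive conditional
measure. Conditioning `v i t` on `B` and extending it to the other variables inside that set gives
an optimal density whose marginal has divergence `-log (v i t) B` from `v i t`
(`exists_extension`), and this tends to zero.
-/

namespace DMSMD

/-! ### Densities and total variation -/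

section Densities

variable {E : Type*} [MeasureSpace E] {p g h : E → ℝ}

theorem aemeasurable_ofReal (hp : Integrable p) :
    AEMeasurable (fun x => ENNReal.ofReal (p x)) :=
  hp.aemeasurable.ennreal_ofReal

theorem pdfMeasure_real_apply (hp : Integrable p) (h0 : ∀ x, 0 ≤ p x) {B : Set E}
    (hB : NullMeasurableSet B) : (pdfMeasure p).real B = ∫ x in B, p x := by
  rw [measureReal_def, pdfMeasure, withDensity_apply₀ _ hB,
    integral_eq_lintegral_of_nonneg_ae (ae_of_all _ h0) hp.aestronglyMeasurable.restrict]

theorem IsPdf.isProbabilityMeasure (hp : IsPdf p) : IsProbabilityMeasure (pdfMeasure p) := by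
  constructor
  rw [pdfMeasure, withDensity_apply _ .univ, Measure.restrict_univ,
    ← ofReal_integral_eq_lintegral_ofReal hp.1 (ae_of_all _ hp.2.2), hp.2.1, ENNReal.ofReal_one]

theorem pdfMeasure_absolutelyContinuous : pdfMeasure p ≪ volume :=
  withDensity_absolutelyContinuous _ _

theorem absolutelyContinuous_pdfMeasure (hp : Integrable p) (hpos : ∀ᵐ x, 0 < p x) :
    volume ≪ pdfMeasure p :=
  withDensity_absolutelyContinuous' (aemeasurable_ofReal hp)
    (hpos.mono fun x hx => by simpa using hx)

/-- Two densities with the same measure agree almost everywhere. -/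
theorem ae_eq_of_pdfMeasure_eq (hp : Integrable p) (hp0 : ∀ x, 0 ≤ p x) (hg : Integrable g)
    (hg0 : ∀ x, 0 ≤ g x) (h : pdfMeasure p = pdfMeasure g) : p =ᵐ[volume] g := by
  have h1 := (withDensity_eq_iff (aemeasurable_ofReal hp) (aemeasurable_ofReal hg)
    (by rw [← ofReal_integral_eq_lintegral_ofReal hp (ae_of_all _ hp0)]; simp)).1 h
  filter_upwards [h1] with x hx
  exact (ENNReal.ofReal_eq_ofReal_iff (hp0 x) (hg0 x)).1 hx

theorem pdfMeasure_congr (h : p =ᵐ[volume] g) : pdfMeasure p = pdfMeasure g :=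
  withDensity_congr_ae (h.mono fun x hx => by simp only [hx])

theorem lintegral_pdfMeasure (hp : Integrable p) (f : E → ℝ≥0∞) (hf : AEMeasurable f) :
    ∫⁻ x, f x ∂pdfMeasure p = ∫⁻ x, ENNReal.ofReal (p x) * f x :=
  lintegral_withDensity_eq_lintegral_mul₀ (aemeasurable_ofReal hp) hf

theorem integrable_pdfMeasure_iff (hp : Integrable p) (h0 : ∀ x, 0 ≤ p x) {f : E → ℝ} :
    Integrable f (pdfMeasure p) ↔ Integrable (fun x => p x * f x) := by
  rw [pdfMeasure, integrable_withDensity_iff_integrable_smul₀' (aemeasurable_ofReal hp)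
    (ae_of_all _ fun x => ENNReal.ofReal_lt_top)]
  simp only [ENNReal.toReal_ofReal (h0 _), smul_eq_mul]

theorem integral_pdfMeasure (hp : Integrable p) (h0 : ∀ x, 0 ≤ p x) (f : E → ℝ) :
    ∫ x, f x ∂pdfMeasure p = ∫ x, p x * f x := by
  rw [pdfMeasure, integral_withDensity_eq_integral_toReal_smul₀ (aemeasurable_ofReal hp)
    (ae_of_all _ fun x => ENNReal.ofReal_lt_top)]
  simp only [ENNReal.toReal_ofReal (h0 _), smul_eq_mul]

theorem tvDist_eq (hp : IsPdf p) (hg : IsPdf g) : tvDist p g =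
    ⨆ B : {B : Set E // MeasurableSet B}, |(pdfMeasure p).real B.1 - (pdfMeasure g).real B.1| := by
  unfold tvDist
  congr 1
  ext B
  rw [pdfMeasure_real_apply hp.1 hp.2.2 B.2.nullMeasurableSet,
    pdfMeasure_real_apply hg.1 hg.2.2 B.2.nullMeasurableSet]

theorem abs_measureReal_sub_le_tvDist (hp : IsPdf p) (hg : IsPdf g) {B : Set E}
    (hB : NullMeasurableSet B) :
    |(pdfMeasure p).real B - (pdfMeasure g).real B| ≤ tvDist p g := by
  have := hp.isProbabilityMeasure
  have := hg.isProbabilityMeasure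
  obtain ⟨C, -, hC, hBC⟩ := hB.exists_measurable_superset_ae_eq
  rw [measureReal_congr (pdfMeasure_absolutelyContinuous.ae_eq hBC.symm),
    measureReal_congr (pdfMeasure_absolutelyContinuous.ae_eq hBC.symm), tvDist_eq hp hg]
  refine le_ciSup (f := fun B : {B : Set E // MeasurableSet B} =>
    |(pdfMeasure p).real B.1 - (pdfMeasure g).real B.1|) ?_ ⟨C, hC⟩
  refine ⟨1, ?_⟩
  rintro _ ⟨D, rfl⟩
  have h1 : (pdfMeasure p).real D.1 ≤ 1 := measureReal_le_one
  have h2 : (pdfMeasure g).real D.1 ≤ 1 := measureReal_le_one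
  have h3 : 0 ≤ (pdfMeasure p).real D.1 := measureReal_nonneg
  have h4 : 0 ≤ (pdfMeasure g).real D.1 := measureReal_nonneg
  rw [abs_le]
  constructor <;> linarith

theorem tvDist_le (hp : IsPdf p) (hg : IsPdf g) {a : ℝ} (h : ∀ B, MeasurableSet B →
    |(pdfMeasure p).real B - (pdfMeasure g).real B| ≤ a) : tvDist p g ≤ a := by
  rw [tvDist_eq hp hg]
  have : Nonempty {B : Set E // MeasurableSet B} := ⟨⟨∅, .empty⟩⟩
  exact ciSup_le fun B => h B.1 B.2

theorem tvDist_nonneg : 0 ≤ tvDist p g :=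
  Real.iSup_nonneg fun _ => abs_nonneg _

theorem tvDist_comm : tvDist p g = tvDist g p := by
  unfold tvDist
  simp_rw [abs_sub_comm]

theorem tvDist_triangle (hp : IsPdf p) (hg : IsPdf g) (hh : IsPdf h) :
    tvDist p h ≤ tvDist p g + tvDist g h :=
  tvDist_le hp hh fun _ hB => (abs_sub_le _ _ _).trans (add_le_add
    (abs_measureReal_sub_le_tvDist hp hg hB.nullMeasurableSet)
    (abs_measureReal_sub_le_tvDist hg hh hB.nullMeasurableSet))

/-- If `g` is within the relative error `a` of `p`, then so is every probability. -/
theorem tvDist_le_of_abs_sub_le (hp : IsPdf p) (hg : IsPdf g) {a : ℝ}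
    (h : ∀ᵐ x, |p x - g x| ≤ a * p x) : tvDist p g ≤ a := by
  refine tvDist_le hp hg fun B hB => ?_
  rw [pdfMeasure_real_apply hp.1 hp.2.2 hB.nullMeasurableSet,
    pdfMeasure_real_apply hg.1 hg.2.2 hB.nullMeasurableSet,
    ← integral_sub hp.1.integrableOn hg.1.integrableOn]
  calc |∫ x in B, (p x - g x)| ≤ ∫ x in B, |p x - g x| := abs_integral_le_integral_abs
    _ ≤ ∫ x, |p x - g x| := setIntegral_le_integral (hp.1.sub hg.1).abs
        (ae_of_all _ fun x => abs_nonneg _)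
    _ ≤ ∫ x, a * p x := integral_mono_ae (hp.1.sub hg.1).abs (hp.1.const_mul a) h
    _ = a := by rw [integral_const_mul, hp.2.1, mul_one]

end Densities

/-! ### Restriction of variables and marginals -/

section Marginals

variable {m : ℕ} {d : Fin m → ℕ} {s t : Finset (Fin m)}

theorem restrictVars_glueVars (h : t ⊆ s) (y : Vars d t) (w : Vars d (s \ t)) :
    restrictVars h (glueVars y w) = y := by
  ext v k
  simp [restrictVars, glueVars, v.2]

@[fun_prop]
theorem measurable_restrictVars (h : t ⊆ s) :
    Measurable (restrictVars h : Vars d s → Vars d t) := by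
  unfold restrictVars
  fun_prop

theorem measurable_glueVars :
    Measurable (fun yw : Vars d t × Vars d (s \ t) => (glueVars yw.1 yw.2 : Vars d s)) := by
  refine measurable_pi_lambda _ fun v => ?_
  unfold glueVars
  by_cases h : v.1 ∈ t
  · simp only [h, dif_pos]; fun_prop
  · simp only [h, dif_neg, not_false_iff]; fun_prop

theorem measurePreserving_glueVars (h : t ⊆ s) :
    MeasurePreserving (fun yw : Vars d t × Vars d (s \ t) => (glueVars yw.1 yw.2 : Vars d s)) := by
  refine ⟨measurable_glueVars, ?_⟩
  refine (Measure.pi_eq fun A hA => ?_).symm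
  rw [Measure.map_apply measurable_glueVars (.univ_pi hA)]
  have hpre : (fun yw : Vars d t × Vars d (s \ t) => (glueVars yw.1 yw.2 : Vars d s)) ⁻¹'
      (Set.univ.pi A) = (Set.univ.pi fun v : t => A ⟨v.1, h v.2⟩) ×ˢ
        (Set.univ.pi fun v : ↥(s \ t) => A ⟨v.1, Finset.sdiff_subset v.2⟩) := by
    ext yw
    simp only [Set.mem_preimage, Set.mem_pi, Set.mem_univ, true_imp_iff, Set.mem_prod]
    constructor
    · intro H
      refine ⟨fun v => ?_, fun v => ?_⟩
      · simpa [glueVars, v.2] using H ⟨v.1, h v.2⟩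
      · simpa [glueVars, (Finset.mem_sdiff.1 v.2).2] using H ⟨v.1, Finset.sdiff_subset v.2⟩
    · rintro ⟨H1, H2⟩ v
      by_cases hv : v.1 ∈ t
      · simpa [glueVars, hv] using H1 ⟨v.1, hv⟩
      · simpa [glueVars, hv] using H2 ⟨v.1, Finset.mem_sdiff.2 ⟨v.2, hv⟩⟩
  rw [hpre, Measure.volume_eq_prod, Measure.prod_prod, volume_pi_pi, volume_pi_pi]
  let F : Fin m → ℝ≥0∞ := fun v => if hv : v ∈ s then volume (A ⟨v, hv⟩) else 1
  have h1 : ∏ v : t, volume (A ⟨v.1, h v.2⟩) = ∏ v ∈ t, F v := by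
    refine (Finset.prod_congr rfl fun v _ => ?_).trans (Finset.prod_coe_sort t F)
    simp [F, h v.2]
  have h2 : ∏ v : ↥(s \ t), volume (A ⟨v.1, Finset.sdiff_subset v.2⟩) = ∏ v ∈ s \ t, F v := by
    refine (Finset.prod_congr rfl fun v _ => ?_).trans (Finset.prod_coe_sort (s \ t) F)
    simp [F, Finset.sdiff_subset v.2]
  have h3 : ∏ v : s, volume (A v) = ∏ v ∈ s, F v := by
    refine (Finset.prod_congr rfl fun v _ => ?_).trans (Finset.prod_coe_sort s F)
    simp [F]
  rw [h1, h2, h3, mul_comm, Finset.prod_sdiff h]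

theorem quasiMeasurePreserving_restrictVars (h : t ⊆ s) :
    Measure.QuasiMeasurePreserving (restrictVars h : Vars d s → Vars d t) := by
  refine ⟨measurable_restrictVars h, Measure.AbsolutelyContinuous.mk fun N hN hN0 => ?_⟩
  rw [Measure.map_apply (measurable_restrictVars h) hN,
    ← (measurePreserving_glueVars h).measure_preimage
      (measurable_restrictVars h hN).nullMeasurableSet]
  have : (fun yw : Vars d t × Vars d (s \ t) => (glueVars yw.1 yw.2 : Vars d s)) ⁻¹'
      (restrictVars h ⁻¹' N) = N ×ˢ Set.univ := by
    ext yw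
    simp [restrictVars_glueVars]
  rw [this, Measure.volume_eq_prod, Measure.prod_prod, hN0, zero_mul]

theorem integrable_glueVars (h : t ⊆ s) {p : Vars d s → ℝ} (hp : Integrable p) :
    Integrable (fun yw : Vars d t × Vars d (s \ t) => p (glueVars yw.1 yw.2))
      ((volume : Measure (Vars d t)).prod (volume : Measure (Vars d (s \ t)))) :=
  (measurePreserving_glueVars h).integrable_comp_of_integrable hp

theorem integrable_marginal (h : t ⊆ s) {p : Vars d s → ℝ} (hp : Integrable p) :
    Integrable (marginal t p) :=
  (integrable_glueVars h hp).integral_prod_left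

theorem marginal_nonneg {p : Vars d s → ℝ} (h0 : ∀ x, 0 ≤ p x) (y : Vars d t) :
    0 ≤ marginal t p y :=
  integral_nonneg fun _ => h0 _

/-- The marginal density is the density of the image measure under restriction. -/
theorem map_restrictVars_pdfMeasure (h : t ⊆ s) {p : Vars d s → ℝ} (hp : Integrable p)
    (h0 : ∀ x, 0 ≤ p x) :
    (pdfMeasure p).map (restrictVars h) = pdfMeasure (marginal t p) := by
  ext B hB
  have hB' := measurable_restrictVars h hB
  have hg := integrable_glueVars h hp
  have hpre : (fun yw : Vars d t × Vars d (s \ t) => (glueVars yw.1 yw.2 : Vars d s)) ⁻¹'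
      (restrictVars h ⁻¹' B) = B ×ˢ Set.univ := by
    ext yw
    simp [restrictVars_glueVars]
  have hmp := (measurePreserving_glueVars (d := d) h).restrict_preimage hB'
  rw [hpre, Measure.volume_eq_prod, ← Measure.prod_restrict, Measure.restrict_univ] at hmp
  rw [Measure.map_apply (measurable_restrictVars h) hB, pdfMeasure, pdfMeasure,
    withDensity_apply _ hB, withDensity_apply _ hB', ← hmp.map_eq,
    lintegral_map' (hmp.map_eq ▸ (aemeasurable_ofReal hp).restrict) hmp.aemeasurable,
    lintegral_prod _ ?_]
  · refine (lintegral_congr_ae ?_)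
    filter_upwards [ae_restrict_of_ae hg.prod_right_ae] with y hy
    exact (ofReal_integral_eq_lintegral_ofReal hy (ae_of_all _ fun _ => h0 _)).symm
  · have := hg.aemeasurable.ennreal_ofReal.restrict (s := B ×ˢ Set.univ)
    rwa [← Measure.prod_restrict, Measure.restrict_univ] at this

theorem IsPdf.marginal (h : t ⊆ s) {p : Vars d s → ℝ} (hp : IsPdf p) :
    IsPdf (marginal t p) := by
  refine ⟨integrable_marginal h hp.1, ?_, marginal_nonneg hp.2.2⟩
  have h1 := pdfMeasure_real_apply (integrable_marginal h hp.1) (marginal_nonneg hp.2.2)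
    (B := Set.univ) .univ
  have := hp.isProbabilityMeasure
  rw [← map_restrictVars_pdfMeasure h hp.1 hp.2.2, setIntegral_univ,
    map_measureReal_apply (measurable_restrictVars h) .univ, Set.preimage_univ,
    probReal_univ] at h1
  exact h1.symm

theorem marginal_pos (h : t ⊆ s) {p : Vars d s → ℝ} (hp : Integrable p)
    (hpos : ∀ᵐ x, 0 < p x) : ∀ᵐ y, 0 < marginal t p y := by
  have h1 := (measurePreserving_glueVars (d := d) h).quasiMeasurePreserving.ae hpos
  filter_upwards [Measure.ae_ae_of_ae_prod h1, (integrable_glueVars h hp).prod_right_ae]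
    with y hy hyi
  unfold DMSMD.marginal
  rw [integral_pos_iff_support_of_nonneg_ae (hy.mono fun w hw => hw.le) hyi]
  have : Function.support (fun w => p (glueVars y w)) =ᵐ[volume] Set.univ :=
    eventuallyEq_univ.2 (hy.mono fun w hw => hw.ne')
  rw [measure_congr this]
  exact Measure.measure_univ_pos.2 (NeZero.ne _)

theorem tvDist_marginal_le (h : t ⊆ s) {p g : Vars d s → ℝ} (hp : IsPdf p) (hg : IsPdf g) :
    tvDist (marginal t p) (marginal t g) ≤ tvDist p g := by
  refine tvDist_le (hp.marginal h) (hg.marginal h) fun B hB => ?_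
  rw [← map_restrictVars_pdfMeasure h hp.1 hp.2.2, ← map_restrictVars_pdfMeasure h hg.1 hg.2.2,
    map_measureReal_apply (measurable_restrictVars h) hB,
    map_measureReal_apply (measurable_restrictVars h) hB]
  exact abs_measureReal_sub_le_tvDist hp hg (measurable_restrictVars h hB).nullMeasurableSet

theorem lintegral_mul_restrictVars (h : t ⊆ s) {p : Vars d s → ℝ} (hp : Integrable p)
    (h0 : ∀ x, 0 ≤ p x) {f : Vars d t → ℝ≥0∞} (hf : AEMeasurable f) :
    ∫⁻ x, ENNReal.ofReal (p x) * f (restrictVars h x)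
      = ∫⁻ y, ENNReal.ofReal (marginal t p y) * f y := by
  rw [← lintegral_pdfMeasure (integrable_marginal h hp) _ hf,
    ← map_restrictVars_pdfMeasure h hp h0,
    lintegral_map' ?_ (measurable_restrictVars h).aemeasurable]
  · exact (lintegral_pdfMeasure hp (fun x => f (restrictVars h x))
      (hf.comp_quasiMeasurePreserving (quasiMeasurePreserving_restrictVars h))).symm
  rw [map_restrictVars_pdfMeasure h hp h0]
  exact hf.mono_ac pdfMeasure_absolutelyContinuous

/-- Marginals over equal sets of variables, given as different expressions, agree. -/
theorem marginal_restrictVars_congr {t' : Finset (Fin m)} (e : t = t') {s' : Finset (Fin m)}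
    (h : t ⊆ s) (h' : t' ⊆ s) (p : Vars d s' → ℝ) (x : Vars d s) :
    marginal t p (restrictVars h x) = marginal t' p (restrictVars h' x) := by
  subst e
  rfl

end Marginals

/-! ### Marginal mixing -/

section Mixing

variable {n m : ℕ} {d : Fin m → ℕ} {S : Fin n → Finset (Fin m)}
  {A : Matrix (Fin n) (Fin n) ℝ} {p : (i : Fin n) → Vars d (S i) → ℝ}

theorem edgeMerge_nonneg (hp : ∀ i, IsPdf (p i)) (i j : Fin n) (x : Vars d (S i)) :
    0 ≤ edgeMerge p i j x :=
  mul_nonneg (div_nonneg ((hp i).2.2 x) (marginal_nonneg (hp i).2.2 _))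
    (marginal_nonneg (hp j).2.2 _)

theorem edgeMerge_pos (hp : ∀ i, IsPdf (p i)) (hpos : ∀ i, ∀ᵐ x, 0 < p i x) (i j : Fin n) :
    ∀ᵐ x, 0 < edgeMerge p i j x := by
  have hq := quasiMeasurePreserving_restrictVars (d := d)
    (Finset.inter_subset_left : S i ∩ S j ⊆ S i)
  filter_upwards [hpos i, hq.ae (marginal_pos Finset.inter_subset_left (hp i).1 (hpos i)),
    hq.ae (marginal_pos Finset.inter_subset_right (hp j).1 (hpos j))] with x h1 h2 h3
  exact mul_pos (div_pos h1 h2) h3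

theorem aestronglyMeasurable_edgeMerge (hp : ∀ i, IsPdf (p i)) (i j : Fin n) :
    AEStronglyMeasurable (edgeMerge p i j) := by
  have hq := quasiMeasurePreserving_restrictVars (d := d)
    (Finset.inter_subset_left : S i ∩ S j ⊆ S i)
  have h1 := (integrable_marginal Finset.inter_subset_left
    (hp i).1).aemeasurable.comp_quasiMeasurePreserving hq
  have h2 := (integrable_marginal Finset.inter_subset_right
    (hp j).1).aemeasurable.comp_quasiMeasurePreserving hq
  exact (((hp i).1.aemeasurable.div h1).mul h2).aestronglyMeasurable

/-- Replacing a marginal of a density by another marginal keeps the total mass one. -/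
theorem lintegral_edgeMerge (hp : ∀ i, IsPdf (p i)) (hpos : ∀ i, ∀ᵐ x, 0 < p i x)
    (i j : Fin n) : ∫⁻ x, ENNReal.ofReal (edgeMerge p i j x) = 1 := by
  have hi := (hp i).marginal (Finset.inter_subset_left : S i ∩ S j ⊆ S i)
  have hj := (hp j).marginal (Finset.inter_subset_right : S i ∩ S j ⊆ S j)
  have hij := marginal_pos (Finset.inter_subset_left : S i ∩ S j ⊆ S i) (hp i).1 (hpos i)
  have h1 := lintegral_mul_restrictVars (Finset.inter_subset_left : S i ∩ S j ⊆ S i) (hp i).1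
    (hp i).2.2 (f := fun y => ENNReal.ofReal
      (marginal (S i ∩ S j) (p j) y / marginal (S i ∩ S j) (p i) y))
    (hj.1.aemeasurable.div hi.1.aemeasurable).ennreal_ofReal
  calc ∫⁻ x, ENNReal.ofReal (edgeMerge p i j x) = _ := ?_
    _ = _ := h1
    _ = ∫⁻ y, ENNReal.ofReal (marginal (S i ∩ S j) (p j) y) := ?_
    _ = 1 := by
      rw [← ofReal_integral_eq_lintegral_ofReal hj.1 (ae_of_all _ hj.2.2), hj.2.1,
        ENNReal.ofReal_one]
  · refine lintegral_congr fun x => ?_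
    rw [← ENNReal.ofReal_mul ((hp i).2.2 x), edgeMerge, div_mul_eq_mul_div, mul_div_assoc]
  · refine lintegral_congr_ae (hij.mono fun y hy => ?_)
    simp only
    rw [← ENNReal.ofReal_mul hy.le, mul_div_cancel₀ _ hy.ne']

theorem integrable_edgeMerge (hp : ∀ i, IsPdf (p i)) (hpos : ∀ i, ∀ᵐ x, 0 < p i x)
    (i j : Fin n) : Integrable (edgeMerge p i j) := by
  refine ⟨aestronglyMeasurable_edgeMerge hp i j, ?_⟩
  rw [hasFiniteIntegral_iff_ofReal (ae_of_all _ (edgeMerge_nonneg hp i j)),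
    lintegral_edgeMerge hp hpos]
  exact ENNReal.one_lt_top

theorem geomPool_nonneg (hp : ∀ i, IsPdf (p i)) (i : Fin n) (x : Vars d (S i)) :
    0 ≤ geomPool A p i x :=
  Finset.prod_nonneg fun j _ => Real.rpow_nonneg (edgeMerge_nonneg hp i j x) _

theorem geomPool_pos (hp : ∀ i, IsPdf (p i)) (hpos : ∀ i, ∀ᵐ x, 0 < p i x) (i : Fin n) :
    ∀ᵐ x, 0 < geomPool A p i x := by
  filter_upwards [ae_all_iff.2 fun j => edgeMerge_pos hp hpos i j] with x hx
  exact Finset.prod_pos fun j _ => Real.rpow_pos_of_pos (hx j) _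

/-- The geometric average is dominated by the arithmetic average. -/
theorem integrable_geomPool (hA0 : ∀ i j, 0 ≤ A i j) (hA1 : ∀ i, ∑ j, A i j = 1)
    (hp : ∀ i, IsPdf (p i)) (hpos : ∀ i, ∀ᵐ x, 0 < p i x) (i : Fin n) :
    Integrable (geomPool A p i) := by
  refine (integrable_finsetSum Finset.univ fun j _ =>
    (integrable_edgeMerge hp hpos i j).const_mul (A i j)).mono' ?_ (ae_of_all _ fun x => ?_)
  · refine AEMeasurable.aestronglyMeasurable ?_
    exact Finset.aemeasurable_fun_prod _ fun j _ =>
      (aestronglyMeasurable_edgeMerge hp i j).aemeasurable.pow_const _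
  · rw [Real.norm_of_nonneg (geomPool_nonneg hp i x)]
    exact Real.geom_mean_le_arith_mean_weighted _ _ _ (fun j _ => hA0 i j) (hA1 i)
      (fun j _ => edgeMerge_nonneg hp i j x)

theorem integral_geomPool_pos (hA0 : ∀ i j, 0 ≤ A i j) (hA1 : ∀ i, ∑ j, A i j = 1)
    (hp : ∀ i, IsPdf (p i)) (hpos : ∀ i, ∀ᵐ x, 0 < p i x) (i : Fin n) :
    0 < ∫ x, geomPool A p i x := by
  rw [integral_pos_iff_support_of_nonneg (geomPool_nonneg hp i)
    (integrable_geomPool hA0 hA1 hp hpos i)]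
  have : Function.support (geomPool A p i) =ᵐ[volume] Set.univ :=
    eventuallyEq_univ.2 ((geomPool_pos hp hpos i).mono fun w hw => hw.ne')
  rw [measure_congr this]
  exact Measure.measure_univ_pos.2 (NeZero.ne _)

theorem isPdf_mixed (hA0 : ∀ i j, 0 ≤ A i j) (hA1 : ∀ i, ∑ j, A i j = 1)
    (hp : ∀ i, IsPdf (p i)) (hpos : ∀ i, ∀ᵐ x, 0 < p i x) (i : Fin n) :
    IsPdf (mixed A p i) := by
  have hZ := integral_geomPool_pos hA0 hA1 hp hpos i
  refine ⟨(integrable_geomPool hA0 hA1 hp hpos i).div_const _, ?_,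
    fun x => div_nonneg (geomPool_nonneg hp i x) hZ.le⟩
  unfold mixed
  rw [integral_div, div_self hZ.ne']

theorem mixed_pos (hA0 : ∀ i j, 0 ≤ A i j) (hA1 : ∀ i, ∑ j, A i j = 1)
    (hp : ∀ i, IsPdf (p i)) (hpos : ∀ i, ∀ᵐ x, 0 < p i x) (i : Fin n) :
    ∀ᵐ x, 0 < mixed A p i x :=
  (geomPool_pos hp hpos i).mono fun _ hx => div_pos hx (integral_geomPool_pos hA0 hA1 hp hpos i)

/-- In the product over all ordered pairs with symmetric stochastic exponents, each factor
`1 / a i j` cancels against `a i j`, contributed by the reversed pair. -/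
theorem prod_prod_rpow_eq_prod {ι : Type*} [Fintype ι] {A : Matrix ι ι ℝ}
    (hA1 : ∀ i, ∑ j, A i j = 1) (hAs : A.IsSymm) {f : ι → ℝ} {a : ι → ι → ℝ}
    (hf : ∀ i, 0 < f i) (ha : ∀ i j, 0 < a i j) :
    ∏ i, ∏ j, (f i / a i j * a j i) ^ A i j = ∏ i, f i := by
  have h1 : ∀ i j, (f i / a i j * a j i) ^ A i j
      = f i ^ A i j / a i j ^ A i j * a j i ^ A i j := fun i j => by
    rw [Real.mul_rpow (div_pos (hf i) (ha i j)).le (ha j i).le,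
      Real.div_rpow (hf i).le (ha i j).le]
  simp_rw [h1, Finset.prod_mul_distrib, Finset.prod_div_distrib]
  have h2 : ∏ i, ∏ j, a j i ^ A i j = ∏ i, ∏ j, a i j ^ A i j := by
    rw [Finset.prod_comm]
    exact Finset.prod_congr rfl fun i _ => Finset.prod_congr rfl fun j _ => by rw [hAs.apply]
  have h3 : ∏ i, ∏ j, a i j ^ A i j ≠ 0 :=
    (Finset.prod_pos fun i _ => Finset.prod_pos fun j _ => Real.rpow_pos_of_pos (ha i j) _).ne'
  rw [h2, div_mul_cancel₀ _ h3]
  exact Finset.prod_congr rfl fun i _ => by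
    rw [← Real.rpow_sum_of_pos (hf i), hA1, Real.rpow_one]

/-- The unnormalized mixing step leaves the product of the agents' densities, as a function of
all variables, unchanged. -/
theorem prod_geomPool (hA1 : ∀ i, ∑ j, A i j = 1) (hAs : A.IsSymm)
    (hp : ∀ i, IsPdf (p i)) (hpos : ∀ i, ∀ᵐ x, 0 < p i x) :
    ∀ᵐ X : Vars d Finset.univ,
      ∏ i, geomPool A p i (restrictVars (Finset.subset_univ (S i)) X)
        = ∏ i, p i (restrictVars (Finset.subset_univ (S i)) X) := by
  have h1 : ∀ᵐ X : Vars d Finset.univ, ∀ i, 0 < p i (restrictVars (Finset.subset_univ (S i)) X) :=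
    ae_all_iff.2 fun i => (quasiMeasurePreserving_restrictVars _).ae (hpos i)
  have h2 : ∀ᵐ X : Vars d Finset.univ, ∀ i j,
      0 < marginal (S i ∩ S j) (p i) (restrictVars (Finset.subset_univ (S i ∩ S j)) X) :=
    ae_all_iff.2 fun i => ae_all_iff.2 fun j => (quasiMeasurePreserving_restrictVars _).ae
      (marginal_pos Finset.inter_subset_left (hp i).1 (hpos i))
  filter_upwards [h1, h2] with X hX1 hX2
  rw [← prod_prod_rpow_eq_prod hA1 hAs hX1 hX2]
  refine Finset.prod_congr rfl fun i _ => Finset.prod_congr rfl fun j _ => ?_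
  rw [marginal_restrictVars_congr (Finset.inter_comm (S j) (S i)) _
    (Finset.subset_univ (S i ∩ S j))]
  rfl

end Mixing

/-! ### The mirror descent step -/

theorem coe_ennreal_eq_coe_toReal {x : ℝ≥0∞} (hx : x ≠ ⊤) : (x : EReal) = (x.toReal : ℝ) := by
  lift x to NNReal using hx
  rfl

section Mirror

variable {E : Type*} [MeasureSpace E] {v p lik : E → ℝ} {a L : ℝ}

theorem norm_mul_log_le {E : Type*} {lik : E → ℝ} {a L : ℝ}
    (hL : ∀ x, |Real.log (lik x)| ≤ L) (x : E) :
    ‖a * Real.log (lik x)‖ ≤ |a| * L := by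
  rw [norm_mul, Real.norm_eq_abs, Real.norm_eq_abs]
  exact mul_le_mul_of_nonneg_left (hL x) (abs_nonneg _)

theorem integrable_exp_mul_log {μ : Measure E} [IsFiniteMeasure μ] (hm : Measurable lik)
    (hL : ∀ x, |Real.log (lik x)| ≤ L) :
    Integrable (fun x => Real.exp (a * Real.log (lik x))) μ := by
  refine Integrable.of_bound (hm.log.const_mul a).exp.aestronglyMeasurable (Real.exp (|a| * L))
    (ae_of_all _ fun x => ?_)
  rw [Real.norm_of_nonneg (Real.exp_pos _).le, Real.exp_le_exp]
  exact (le_abs_self _).trans (norm_mul_log_le hL x)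

/-- Bayes' rule with the tempered likelihood `lik ^ a`, written as `exp (a * log lik)`. -/
noncomputable def temperedPosterior (a : ℝ) (lik v : E → ℝ) (x : E) : ℝ :=
  v x * Real.exp (a * Real.log (lik x)) / ∫ y, v y * Real.exp (a * Real.log (lik y))

theorem integrable_mul_exp (hv : IsPdf v) (hm : Measurable lik)
    (hL : ∀ x, |Real.log (lik x)| ≤ L) :
    Integrable (fun x => v x * Real.exp (a * Real.log (lik x))) := by
  have := hv.isProbabilityMeasure
  exact (integrable_pdfMeasure_iff hv.1 hv.2.2).1 (integrable_exp_mul_log hm hL)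

theorem integral_mul_exp_mem (hv : IsPdf v) (hm : Measurable lik)
    (hL : ∀ x, |Real.log (lik x)| ≤ L) :
    (∫ x, v x * Real.exp (a * Real.log (lik x)))
      ∈ Set.Icc (Real.exp (-(|a| * L))) (Real.exp (|a| * L)) := by
  have hi := integrable_mul_exp (a := a) hv hm hL
  have hb := fun x => abs_le.1 (norm_mul_log_le (a := a) hL x)
  constructor
  · calc Real.exp (-(|a| * L)) = ∫ x, v x * Real.exp (-(|a| * L)) := by
          rw [integral_mul_const, hv.2.1, one_mul]
      _ ≤ _ := integral_mono (hv.1.mul_const _) hi fun x =>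
          mul_le_mul_of_nonneg_left (Real.exp_le_exp.2 (hb x).1) (hv.2.2 x)
  · calc _ ≤ ∫ x, v x * Real.exp (|a| * L) := integral_mono hi (hv.1.mul_const _) fun x =>
          mul_le_mul_of_nonneg_left (Real.exp_le_exp.2 (hb x).2) (hv.2.2 x)
      _ = _ := by rw [integral_mul_const, hv.2.1, one_mul]

theorem integral_mul_exp_pos (hv : IsPdf v) (hm : Measurable lik)
    (hL : ∀ x, |Real.log (lik x)| ≤ L) :
    0 < ∫ x, v x * Real.exp (a * Real.log (lik x)) :=
  (Real.exp_pos _).trans_le (integral_mul_exp_mem hv hm hL).1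

theorem isPdf_temperedPosterior (hv : IsPdf v) (hm : Measurable lik)
    (hL : ∀ x, |Real.log (lik x)| ≤ L) : IsPdf (temperedPosterior a lik v) := by
  have hZ := integral_mul_exp_pos (a := a) hv hm hL
  refine ⟨(integrable_mul_exp hv hm hL).div_const _, ?_, fun x =>
    div_nonneg (mul_nonneg (hv.2.2 x) (Real.exp_pos _).le) hZ.le⟩
  unfold temperedPosterior
  rw [integral_div, div_self hZ.ne']

theorem pdfMeasure_temperedPosterior (hv : IsPdf v) (hm : Measurable lik) :
    pdfMeasure (temperedPosterior a lik v)
      = (pdfMeasure v).tilted (fun x => a * Real.log (lik x)) := by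
  unfold Measure.tilted
  rw [integral_pdfMeasure hv.1 hv.2.2]
  rw [pdfMeasure, pdfMeasure, ← withDensity_mul₀ (aemeasurable_ofReal hv.1) (by fun_prop)]
  congr 1
  ext x
  rw [Pi.mul_apply, ← ENNReal.ofReal_mul (hv.2.2 x), temperedPosterior, mul_div_assoc]

/-- Gibbs' variational principle: the mirror descent functional has the tempered posterior as its
only minimizer, up to null sets. -/
theorem ae_eq_temperedPosterior (hv : IsPdf v) (hm : Measurable lik)
    (hL : ∀ x, |Real.log (lik x)| ≤ L) (hp : IsPdf p)
    (hmin : ∀ g, IsPdf g → mirrorObjective a lik v p ≤ mirrorObjective a lik v g) :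
    p =ᵐ[volume] temperedPosterior a lik v := by
  have hw := isPdf_temperedPosterior (a := a) hv hm hL
  have hwm := pdfMeasure_temperedPosterior (a := a) hv hm
  have := hv.isProbabilityMeasure
  have := hp.isProbabilityMeasure
  have := hw.isProbabilityMeasure
  set f : E → ℝ := fun x => a * Real.log (lik x) with hf
  have hfm : Measurable f := by fun_prop
  have hfi : ∀ μ : Measure E, IsFiniteMeasure μ → Integrable f μ := fun μ _ =>
    Integrable.of_bound hfm.aestronglyMeasurable (|a| * L) (ae_of_all _ (norm_mul_log_le hL))
  have hexp : Integrable (fun x => Real.exp (f x)) (pdfMeasure v) := integrable_exp_mul_log hm hL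
  have hlin : ∀ g, IsPdf g → a * ∫ x, -Real.log (lik x) * g x = -∫ x, f x ∂pdfMeasure g :=
    fun g hg => by
      rw [integral_pdfMeasure hg.1 hg.2.2, ← integral_const_mul, ← integral_neg]
      congr 1
      ext x
      simp only [hf]
      ring
  -- the value at the tempered posterior
  have hac : pdfMeasure (temperedPosterior a lik v) ≪ pdfMeasure v := by
    rw [hwm]; exact tilted_absolutelyContinuous _ _
  have hllr : llr (pdfMeasure (temperedPosterior a lik v)) (pdfMeasure v)
      =ᵐ[pdfMeasure (temperedPosterior a lik v)]
        fun x => f x - Real.log (∫ z, Real.exp (f z) ∂pdfMeasure v) := by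
    refine hac.ae_le ?_
    rw [hwm]
    exact log_rnDeriv_tilted_left_self hexp
  have hllri : Integrable (llr (pdfMeasure (temperedPosterior a lik v)) (pdfMeasure v))
      (pdfMeasure (temperedPosterior a lik v)) :=
    ((hfi _ inferInstance).sub (integrable_const _)).congr hllr.symm
  have hobjw : mirrorObjective a lik v (temperedPosterior a lik v)
      = ((-Real.log (∫ z, Real.exp (f z) ∂pdfMeasure v) : ℝ) : EReal) := by
    have h1 : (KL (temperedPosterior a lik v) v).toReal
        = ∫ x, f x ∂pdfMeasure (temperedPosterior a lik v)
          - Real.log (∫ z, Real.exp (f z) ∂pdfMeasure v) := by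
      rw [KL, InformationTheory.toReal_klDiv_of_measure_eq hac (by simp), integral_congr_ae hllr,
        integral_sub (hfi _ inferInstance) (integrable_const _)]
      simp
    have h2 : KL (temperedPosterior a lik v) v ≠ ⊤ := InformationTheory.klDiv_ne_top hac hllri
    rw [mirrorObjective, hlin _ hw, coe_ennreal_eq_coe_toReal h2, ← EReal.coe_add, h1]
    congr 1
    ring
  -- the excess of the value at `p` is the divergence of `p` from the tempered posterior
  have hle := hmin _ hw
  rw [hobjw, mirrorObjective, hlin _ hp] at hle
  have hfin : KL p v ≠ ⊤ := by
    intro h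
    rw [h] at hle
    simp at hle
  obtain ⟨hpv, hpi⟩ := InformationTheory.klDiv_ne_top_iff.1 hfin
  have hKL : (KL p v).toReal = ∫ x, llr (pdfMeasure p) (pdfMeasure v) x ∂pdfMeasure p :=
    InformationTheory.toReal_klDiv_of_measure_eq hpv (by simp)
  have hle' : -∫ x, f x ∂pdfMeasure p + (KL p v).toReal
      ≤ -Real.log (∫ z, Real.exp (f z) ∂pdfMeasure v) := by
    rwa [coe_ennreal_eq_coe_toReal hfin, ← EReal.coe_add, EReal.coe_le_coe_iff] at hle
  have hpw : pdfMeasure p ≪ pdfMeasure (temperedPosterior a lik v) := by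
    rw [hwm]; exact hpv.trans (absolutelyContinuous_tilted hexp)
  have hzero : (KL p (temperedPosterior a lik v)).toReal ≤ 0 := by
    rw [KL, InformationTheory.toReal_klDiv_of_measure_eq hpw (by simp), hwm,
      integral_llr_tilted_right hpv (hfi _ inferInstance) hexp hpi, ← hKL]
    linarith
  have hne : KL p (temperedPosterior a lik v) ≠ ⊤ := by
    refine InformationTheory.klDiv_ne_top hpw ?_
    rw [hwm]
    exact integrable_llr_tilted_right hpv (hfi _ inferInstance) hpi hexp
  have hz : KL p (temperedPosterior a lik v) = 0 :=
    ((ENNReal.toReal_eq_zero_iff _).1 (le_antisymm hzero ENNReal.toReal_nonneg)).resolve_right hne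
  exact ae_eq_of_pdfMeasure_eq hp.1 hp.2.2 hw.1 hw.2.2 (InformationTheory.klDiv_eq_zero_iff.1 hz)

theorem temperedPosterior_pos (hv : IsPdf v) (hpos : ∀ᵐ x, 0 < v x) (hm : Measurable lik)
    (hL : ∀ x, |Real.log (lik x)| ≤ L) : ∀ᵐ x, 0 < temperedPosterior a lik v x :=
  hpos.mono fun _ hx => div_pos (mul_pos hx (Real.exp_pos _)) (integral_mul_exp_pos hv hm hL)

/-- A single tempered update moves a density by at most `exp (2 |a| L) - 1`. -/
theorem tvDist_temperedPosterior_le (hv : IsPdf v) (hm : Measurable lik)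
    (hL : ∀ x, |Real.log (lik x)| ≤ L) :
    tvDist v (temperedPosterior a lik v) ≤ Real.exp (2 * (|a| * L)) - 1 := by
  refine tvDist_le_of_abs_sub_le hv (isPdf_temperedPosterior hv hm hL) (ae_of_all _ fun x => ?_)
  have hZ := integral_mul_exp_mem (a := a) hv hm hL
  have hZ0 := integral_mul_exp_pos (a := a) hv hm hL
  have hb := abs_le.1 (norm_mul_log_le (a := a) hL x)
  set Z := ∫ y, v y * Real.exp (a * Real.log (lik y)) with hZdef
  have h1 : temperedPosterior a lik v x = v x * (Real.exp (a * Real.log (lik x)) / Z) := by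
    rw [temperedPosterior, mul_div_assoc]
  have h2 : Real.exp (a * Real.log (lik x)) / Z ≤ Real.exp (2 * (|a| * L)) := by
    rw [div_le_iff₀ hZ0]
    calc _ ≤ Real.exp (|a| * L) := Real.exp_le_exp.2 hb.2
      _ = Real.exp (2 * (|a| * L)) * Real.exp (-(|a| * L)) := by rw [← Real.exp_add]; ring_nf
      _ ≤ _ := mul_le_mul_of_nonneg_left hZ.1 (Real.exp_pos _).le
  have h3 : Real.exp (-(2 * (|a| * L))) ≤ Real.exp (a * Real.log (lik x)) / Z := by
    rw [le_div_iff₀ hZ0]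
    calc _ ≤ Real.exp (-(2 * (|a| * L))) * Real.exp (|a| * L) :=
          mul_le_mul_of_nonneg_left hZ.2 (Real.exp_pos _).le
      _ = Real.exp (-(|a| * L)) := by rw [← Real.exp_add]; ring_nf
      _ ≤ _ := Real.exp_le_exp.2 hb.1
  have h4 : 2 - Real.exp (2 * (|a| * L)) ≤ Real.exp (-(2 * (|a| * L))) := by
    rw [Real.exp_neg]
    have := Real.exp_pos (2 * (|a| * L))
    rw [← one_div, le_div_iff₀ this]
    nlinarith [sq_nonneg (Real.exp (2 * (|a| * L)) - 1)]
  rw [h1, ← mul_one_sub, abs_mul, abs_of_nonneg (hv.2.2 x), mul_comm]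
  refine mul_le_mul_of_nonneg_right (abs_le.2 ⟨?_, ?_⟩) (hv.2.2 x) <;> linarith

end Mirror

/-! ### Joint control of the agents' densities -/

theorem measureReal_preimage_restrictVars {m : ℕ} {d : Fin m → ℕ} {s t : Finset (Fin m)}
    (h : t ⊆ s) {p : Vars d s → ℝ} (hp : IsPdf p) {B : Set (Vars d t)}
    (hB : NullMeasurableSet B) :
    (pdfMeasure p).real (restrictVars h ⁻¹' B) = (pdfMeasure (marginal t p)).real B := by
  have hmap := map_restrictVars_pdfMeasure h hp.1 hp.2.2
  rw [measureReal_def, measureReal_def, ← hmap, Measure.map_apply₀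
    (measurable_restrictVars h).aemeasurable
    (by rw [hmap]; exact hB.mono_ac pdfMeasure_absolutelyContinuous)]

section Joint

variable {n m : ℕ} {d : Fin m → ℕ} {S : Fin n → Finset (Fin m)}

/-- Densities `v i` whose product is dominated by that of the integrable functions `b i` are
individually dominated, up to a small mass, provided that they are almost the marginals of one
joint density `r`. Indeed `v j` is rarely below `b j / R` under `v j` itself, hence under `r`;
where no `v j` is below `b j / R`, the product formula bounds each `v i` by a multiple of `b i`. -/
theorem measureReal_le_of_prod_eq {v b : (i : Fin n) → Vars d (S i) → ℝ}
    (hv : ∀ i, IsPdf (v i)) (hpos : ∀ i, ∀ᵐ x, 0 < v i x)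
    (hb : ∀ i, Integrable (b i)) (hb0 : ∀ i x, 0 ≤ b i x) {c : ℝ} (hc : 0 ≤ c)
    (hprod : ∀ᵐ X : Vars d Finset.univ,
      ∏ i, v i (restrictVars (Finset.subset_univ (S i)) X)
        = c * ∏ i, b i (restrictVars (Finset.subset_univ (S i)) X))
    {r : Vars d Finset.univ → ℝ} (hr : IsPdf r) {e M R : ℝ}
    (he : ∀ i, tvDist (v i) (marginal (S i) r) ≤ e) (hM : ∀ i, ∫ x, b i x ≤ M) (hR : 0 < R)
    (i : Fin n) {B : Set (Vars d (S i))} (hB : NullMeasurableSet B) :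
    (pdfMeasure (v i)).real B ≤ n * (M / R + e) + e + c * R ^ (n - 1) * ∫ x in B, b i x := by
  have := fun j => (hv j).isProbabilityMeasure
  have := hr.isProbabilityMeasure
  have hrm := fun j => hr.marginal (Finset.subset_univ (S j))
  have := fun j => (hrm j).isProbabilityMeasure
  set E : (j : Fin n) → Set (Vars d (S j)) := fun j => {x | R * v j x < b j x} with hE
  have hEm : ∀ j, NullMeasurableSet (E j) := fun j =>
    nullMeasurableSet_lt ((hv j).1.aemeasurable.const_mul R) (hb j).aemeasurable
  have hEv : ∀ j, (pdfMeasure (v j)).real (E j) ≤ M / R := fun j => by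
    rw [pdfMeasure_real_apply (hv j).1 (hv j).2.2 (hEm j), le_div_iff₀ hR, mul_comm,
      ← integral_const_mul]
    calc ∫ x in E j, R * v j x ≤ ∫ x in E j, b j x :=
          setIntegral_mono_on_ae₀ ((hv j).1.const_mul R).integrableOn (hb j).integrableOn (hEm j)
            (ae_of_all _ fun x hx => le_of_lt hx)
      _ ≤ ∫ x, b j x := setIntegral_le_integral (hb j) (ae_of_all _ (hb0 j))
      _ ≤ M := hM j
  have hEr : ∀ j, (pdfMeasure r).real (restrictVars (Finset.subset_univ (S j)) ⁻¹' E j)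
      ≤ M / R + e := fun j => by
    rw [measureReal_preimage_restrictVars _ hr (hEm j)]
    have h1 := abs_le.1 ((abs_measureReal_sub_le_tvDist (hv j) (hrm j) (hEm j)).trans (he j))
    linarith [hEv j]
  set D : Set (Vars d (S i)) := {x | c * R ^ (n - 1) * b i x < v i x} with hD
  have hDm : NullMeasurableSet D :=
    nullMeasurableSet_lt ((hb i).aemeasurable.const_mul _) (hv i).1.aemeasurable
  have hposX : ∀ᵐ X : Vars d Finset.univ,
      ∀ j, 0 < v j (restrictVars (Finset.subset_univ (S j)) X) :=
    ae_all_iff.2 fun j => (quasiMeasurePreserving_restrictVars _).ae (hpos j)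
  have hsub : restrictVars (Finset.subset_univ (S i)) ⁻¹' D ≤ᵐ[(volume : Measure (Vars d _))]
      ⋃ j, restrictVars (Finset.subset_univ (S j)) ⁻¹' E j := by
    filter_upwards [hprod, hposX] with X hX hX0 hXD
    by_contra hcon
    have hcon' : ∀ j, b j (restrictVars (Finset.subset_univ (S j)) X)
        ≤ R * v j (restrictVars (Finset.subset_univ (S j)) X) := by
      intro j
      by_contra hj
      exact hcon (Set.mem_iUnion.2 ⟨j, not_le.1 hj⟩)
    have hXD' : c * R ^ (n - 1) * b i (restrictVars (Finset.subset_univ (S i)) X)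
      < v i (restrictVars (Finset.subset_univ (S i)) X) := hXD
    have hP : 0 < ∏ j ∈ Finset.univ.erase i, v j (restrictVars (Finset.subset_univ (S j)) X) :=
      Finset.prod_pos fun j _ => hX0 j
    have h1 : ∏ j ∈ Finset.univ.erase i, b j (restrictVars (Finset.subset_univ (S j)) X)
        ≤ R ^ (n - 1) *
          ∏ j ∈ Finset.univ.erase i, v j (restrictVars (Finset.subset_univ (S j)) X) := by
      refine (Finset.prod_le_prod (fun j _ => hb0 j _) fun j _ => hcon' j).trans_eq ?_
      rw [Finset.prod_mul_distrib, Finset.prod_const, Finset.card_erase_of_mem (Finset.mem_univ _),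
        Finset.card_univ, Fintype.card_fin]
    rw [← Finset.mul_prod_erase _ _ (Finset.mem_univ i),
      ← Finset.mul_prod_erase _ _ (Finset.mem_univ i)] at hX
    have h2 := mul_le_mul_of_nonneg_left h1
      (mul_nonneg hc (hb0 i (restrictVars (Finset.subset_univ (S i)) X)))
    have h3 := mul_lt_mul_of_pos_right hXD' hP
    rw [hX] at h3
    linarith
  have hDr : (pdfMeasure (marginal (S i) r)).real D ≤ n * (M / R + e) := by
    rw [← measureReal_preimage_restrictVars (Finset.subset_univ _) hr hDm]
    calc _ ≤ (pdfMeasure r).real (⋃ j, restrictVars (Finset.subset_univ (S j)) ⁻¹' E j) :=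
          ENNReal.toReal_mono (measure_ne_top _ _)
            (measure_mono_ae (pdfMeasure_absolutelyContinuous.ae_le hsub))
      _ ≤ ∑ j, (pdfMeasure r).real (restrictVars (Finset.subset_univ (S j)) ⁻¹' E j) :=
          measureReal_iUnion_fintype_le _
      _ ≤ ∑ _j : Fin n, (M / R + e) := Finset.sum_le_sum fun j _ => hEr j
      _ = n * (M / R + e) := by
        rw [Finset.sum_const, Finset.card_univ, Fintype.card_fin, nsmul_eq_mul]
  have hDv : (pdfMeasure (v i)).real D ≤ n * (M / R + e) + e := by
    have h1 := abs_le.1 ((abs_measureReal_sub_le_tvDist (hv i) (hrm i) hDm).trans (he i))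
    linarith
  have hc' : 0 ≤ c * R ^ (n - 1) := mul_nonneg hc (pow_pos hR _).le
  have hBD : (pdfMeasure (v i)).real (B \ D) ≤ c * R ^ (n - 1) * ∫ x in B, b i x := by
    rw [pdfMeasure_real_apply (hv i).1 (hv i).2.2 (hB.diff hDm), ← integral_const_mul]
    calc ∫ x in B \ D, v i x ≤ ∫ x in B \ D, c * R ^ (n - 1) * b i x :=
          setIntegral_mono_on_ae₀ (hv i).1.integrableOn ((hb i).const_mul _).integrableOn
            (hB.diff hDm) (ae_of_all _ fun x hx => not_lt.1 hx.2)
      _ ≤ ∫ x in B, c * R ^ (n - 1) * b i x :=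
          setIntegral_mono_set ((hb i).const_mul _).integrableOn
            (ae_of_all _ fun x => mul_nonneg hc' (hb0 i x)) Set.sdiff_subset.eventuallyLE
  calc (pdfMeasure (v i)).real B ≤ (pdfMeasure (v i)).real (D ∪ B \ D) :=
        measureReal_mono (by simp)
    _ ≤ (pdfMeasure (v i)).real D + (pdfMeasure (v i)).real (B \ D) := measureReal_union_le _ _
    _ ≤ _ := add_le_add hDv hBD

/-- The constant in a product formula for densities is bounded uniformly over the densities `v`:
with large probability under `r`, no `v i` exceeds a large multiple of `p0 i`. -/
theorem exists_bound_of_prod_eq {p0 : (i : Fin n) → Vars d (S i) → ℝ} (hp0 : ∀ i, IsPdf (p0 i))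
    (hpos : ∀ i, ∀ᵐ x, 0 < p0 i x) {r : Vars d Finset.univ → ℝ} (hr : IsPdf r) :
    ∃ K : ℝ, ∀ v : (i : Fin n) → Vars d (S i) → ℝ, (∀ i, IsPdf (v i)) → ∀ c : ℝ,
      (∀ᵐ X ∂pdfMeasure r, ∏ i, v i (restrictVars (Finset.subset_univ (S i)) X)
        = c * ∏ i, p0 i (restrictVars (Finset.subset_univ (S i)) X)) → c ≤ K := by
  have := fun j => (hp0 j).isProbabilityMeasure
  have := hr.isProbabilityMeasure
  have hrm := fun j => hr.marginal (Finset.subset_univ (S j))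
  have := fun j => (hrm j).isProbabilityMeasure
  have hac : ∀ i, pdfMeasure (marginal (S i) r) ≪ pdfMeasure (p0 i) := fun i =>
    pdfMeasure_absolutelyContinuous.trans (absolutelyContinuous_pdfMeasure (hp0 i).1 (hpos i))
  have hδ : ∀ i, ∃ δ > 0, ∀ F : Set (Vars d (S i)), pdfMeasure (p0 i) F < δ →
      pdfMeasure (marginal (S i) r) F < ENNReal.ofReal (1 / (n + 1)) := fun i => by
    obtain ⟨δ, hδ, H⟩ := exists_pos_setLIntegral_lt_of_measure_lt
      (μ := pdfMeasure (p0 i)) (f := (pdfMeasure (marginal (S i) r)).rnDeriv (pdfMeasure (p0 i)))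
      (Measure.lintegral_rnDeriv_lt_top _ _).ne (ε := ENNReal.ofReal (1 / (n + 1)))
      (by simp; positivity)
    refine ⟨δ, hδ, fun F hF => ?_⟩
    have := Measure.haveLebesgueDecomposition_of_sigmaFinite
      (pdfMeasure (marginal (S i) r)) (pdfMeasure (p0 i))
    rw [← Measure.setLIntegral_rnDeriv (hac i) F]
    exact H F hF
  choose δ hδ0 hδ using hδ
  have hlim : Tendsto (fun Λ : ℝ => ENNReal.ofReal Λ⁻¹) atTop (𝓝 0) := by
    simpa using ENNReal.tendsto_ofReal tendsto_inv_atTop_zero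
  -- `p0 i (v i > Λ * p0 i) ≤ 1 / Λ`, so this `Λ` makes the event have `r`-probability below
  -- `1 / (n + 1)` for each `i`, which leaves room for a union bound over the `n` agents
  obtain ⟨Λ, hΛ, hΛ0⟩ := ((eventually_all.2 fun i => hlim.eventually_lt_const (hδ0 i)).and
    (eventually_gt_atTop 0)).exists
  refine ⟨Λ ^ n, fun v hv c hc => ?_⟩
  have := fun j => (hv j).isProbabilityMeasure
  set F : (j : Fin n) → Set (Vars d (S j)) := fun j => {x | Λ * p0 j x < v j x} with hF
  have hFm : ∀ j, NullMeasurableSet (F j) := fun j =>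
    nullMeasurableSet_lt ((hp0 j).1.aemeasurable.const_mul Λ) (hv j).1.aemeasurable
  have hFp : ∀ j, pdfMeasure (p0 j) (F j) < δ j := fun j => by
    refine lt_of_le_of_lt ?_ (hΛ j)
    rw [← ofReal_measureReal, pdfMeasure_real_apply (hp0 j).1 (hp0 j).2.2 (hFm j)]
    refine ENNReal.ofReal_le_ofReal ?_
    rw [← one_div, le_div_iff₀ hΛ0, mul_comm, ← integral_const_mul]
    calc ∫ x in F j, Λ * p0 j x ≤ ∫ x in F j, v j x :=
          setIntegral_mono_on_ae₀ ((hp0 j).1.const_mul Λ).integrableOn (hv j).1.integrableOn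
            (hFm j) (ae_of_all _ fun x hx => le_of_lt hx)
      _ ≤ ∫ x, v j x := setIntegral_le_integral (hv j).1 (ae_of_all _ (hv j).2.2)
      _ = 1 := (hv j).2.1
  have hFr : ∀ j, (pdfMeasure r).real (restrictVars (Finset.subset_univ (S j)) ⁻¹' F j)
      ≤ 1 / (n + 1) := fun j => by
    rw [measureReal_preimage_restrictVars _ hr (hFm j)]
    exact ENNReal.toReal_le_of_le_ofReal (by positivity) (hδ j _ (hFp j)).le
  have hU : (pdfMeasure r).real (⋃ j, restrictVars (Finset.subset_univ (S j)) ⁻¹' F j) < 1 := by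
    calc _ ≤ ∑ j, (pdfMeasure r).real (restrictVars (Finset.subset_univ (S j)) ⁻¹' F j) :=
          measureReal_iUnion_fintype_le _
      _ ≤ ∑ _j : Fin n, (1 / (n + 1) : ℝ) := Finset.sum_le_sum fun j _ => hFr j
      _ = n / (n + 1) := by simp [div_eq_mul_inv]
      _ < 1 := by rw [div_lt_one (by positivity)]; linarith
  have hposX : ∀ᵐ X ∂pdfMeasure r,
      ∀ j, 0 < p0 j (restrictVars (Finset.subset_univ (S j)) X) :=
    pdfMeasure_absolutelyContinuous.ae_le
      (ae_all_iff.2 fun j => (quasiMeasurePreserving_restrictVars _).ae (hpos j))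
  have hex : ∃ᵐ X ∂pdfMeasure r,
      X ∉ ⋃ j, restrictVars (Finset.subset_univ (S j)) ⁻¹' F j := by
    intro hcon
    have h1 : ∀ᵐ X ∂pdfMeasure r,
        X ∈ ⋃ j, restrictVars (Finset.subset_univ (S j)) ⁻¹' F j :=
      hcon.mono fun X hX => not_not.1 hX
    have h2 : (⋃ j, restrictVars (Finset.subset_univ (S j)) ⁻¹' F j) =ᵐ[pdfMeasure r] Set.univ :=
      eventuallyEq_univ.2 h1
    rw [measureReal_congr h2, probReal_univ] at hU
    exact lt_irrefl _ hU
  obtain ⟨X, hX1, hX2, hX3⟩ := (hex.and_eventually (hc.and hposX)).exists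
  have hle : ∀ j, v j (restrictVars (Finset.subset_univ (S j)) X)
      ≤ Λ * p0 j (restrictVars (Finset.subset_univ (S j)) X) := by
    intro j
    by_contra hj
    exact hX1 (Set.mem_iUnion.2 ⟨j, not_le.1 hj⟩)
  have hP := Finset.prod_pos fun j (_ : j ∈ Finset.univ) => hX3 j
  have h1 := Finset.prod_le_prod (s := Finset.univ) (fun j _ => (hv j).2.2 _) fun j _ => hle j
  rw [hX2, Finset.prod_mul_distrib, Finset.prod_const, Finset.card_univ, Fintype.card_fin] at h1
  exact le_of_mul_le_mul_right h1 hP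

end Joint

/-! ### Trajectories of the algorithm -/

theorem tendsto_zero_of_le_mul_add {e b : ℕ → ℝ} {σ : ℝ} (hσ0 : 0 ≤ σ) (hσ1 : σ < 1)
    (he : ∀ t, 0 ≤ e t) (hb : Tendsto b atTop (𝓝 0)) (h : ∀ t, e (t + 1) ≤ σ * e t + b t) :
    Tendsto e atTop (𝓝 0) := by
  refine tendsto_order.2 ⟨fun a ha => .of_forall fun t => ha.trans_le (he t), fun ε hε => ?_⟩
  have hσ' : 0 < 1 - σ := by linarith
  obtain ⟨N, hN⟩ := eventually_atTop.1 (hb.eventually_lt_const (mul_pos (half_pos hε) hσ'))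
  have hk : ∀ k, e (N + k) ≤ σ ^ k * e N + ε / 2 := fun k => by
    induction k with
    | zero => rw [pow_zero, one_mul, add_zero]; linarith
    | succ k ih =>
      have h1 := h (N + k)
      have h2 := hN (N + k) (Nat.le_add_right _ _)
      have h3 := mul_le_mul_of_nonneg_left ih hσ0
      calc e (N + (k + 1)) ≤ σ * (σ ^ k * e N + ε / 2) + ε / 2 * (1 - σ) := by
            rw [← add_assoc]; linarith
        _ = σ ^ (k + 1) * e N + ε / 2 := by ring
  have hlim : Tendsto (fun k => σ ^ k * e N + ε / 2) atTop (𝓝 (0 * e N + ε / 2)) :=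
    ((tendsto_pow_atTop_nhds_zero_of_lt_one hσ0 hσ1).mul_const _).add_const _
  obtain ⟨K, hK⟩ := eventually_atTop.1 (hlim.eventually_lt_const (by linarith : _ < ε))
  filter_upwards [eventually_ge_atTop (N + K)] with t ht
  obtain ⟨k, rfl⟩ := Nat.exists_eq_add_of_le (show N ≤ t by omega)
  exact (hk k).trans_lt (hK k (by omega))

section Trajectory

variable {n m : ℕ} {d : Fin m → ℕ} {ℓ : Fin n → ℕ} {S : Fin n → Finset (Fin m)}

/-- The tempered likelihood ratio `∏_{s < t} (q (z s) x / q (z s) x') ^ α s` of the parameters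
`x` and `x'` for the measurements `z` of one agent. The powers are written through logarithms,
which makes the ratio positive everywhere; the likelihoods are positive where it is used. -/
noncomputable def likelihoodRatio {Y E : Type*} (q : Y → E → ℝ) (α : ℕ → ℝ) (x' : E) (z : ℕ → Y)
    (t : ℕ) (x : E) : ℝ :=
  ∏ s ∈ Finset.range t, Real.exp (α s * (Real.log (q (z s) x) - Real.log (q (z s) x')))

theorem likelihoodRatio_pos {Y E : Type*} (q : Y → E → ℝ) (α : ℕ → ℝ) (x' : E) (z : ℕ → Y)
    (t : ℕ) (x : E) : 0 < likelihoodRatio q α x' z t x :=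
  Finset.prod_pos fun _ _ => Real.exp_pos _

variable {A : Matrix (Fin n) (Fin n) ℝ} {q : (i : Fin n) → (Fin (ℓ i) → ℝ) → Vars d (S i) → ℝ}
  {α : ℕ → ℝ} {p0 : (i : Fin n) → Vars d (S i) → ℝ} {z : ℕ → (i : Fin n) → Fin (ℓ i) → ℝ}
  {p : ℕ → (i : Fin n) → Vars d (S i) → ℝ} {L : ℝ}

theorem IsGenerated.ae_eq (h : IsGenerated A q α p0 z p)
    (hq : ∀ i, Measurable (Function.uncurry (q i)))
    (hL : ∀ t i x, |Real.log (q i (z t i) x)| ≤ L) {t : ℕ} {i : Fin n}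
    (hv : IsPdf (mixed A (p t) i)) :
    p (t + 1) i =ᵐ[volume] temperedPosterior (α t) (q i (z t i)) (mixed A (p t) i) :=
  ae_eq_temperedPosterior hv ((hq i).comp measurable_prodMk_left) (hL t i) (h.2 t i).1 (h.2 t i).2

theorem IsGenerated.isPdf_and_pos (h : IsGenerated A q α p0 z p)
    (hq : ∀ i, Measurable (Function.uncurry (q i)))
    (hL : ∀ t i x, |Real.log (q i (z t i) x)| ≤ L)
    (hA0 : ∀ i j, 0 ≤ A i j) (hA1 : ∀ i, ∑ j, A i j = 1)
    (hp0 : ∀ i, IsPdf (p0 i)) (hpos : ∀ i x, 0 < p0 i x) (t : ℕ) :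
    (∀ i, IsPdf (p t i)) ∧ ∀ i, ∀ᵐ x, 0 < p t i x := by
  induction t with
  | zero =>
    rw [h.1]
    exact ⟨hp0, fun i => ae_of_all _ (hpos i)⟩
  | succ t ih =>
    refine ⟨fun i => (h.2 t i).1, fun i => ?_⟩
    have hv := isPdf_mixed hA0 hA1 ih.1 ih.2 i
    filter_upwards [h.ae_eq hq hL hv, temperedPosterior_pos (a := α t) hv
      (mixed_pos hA0 hA1 ih.1 ih.2 i) ((hq i).comp measurable_prodMk_left) (hL t i)] with x h1 h2
    rw [h1]
    exact h2

theorem exists_prod_mixed_eq (hA0 : ∀ i j, 0 ≤ A i j) (hA1 : ∀ i, ∑ j, A i j = 1)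
    (hAs : A.IsSymm) {p : (i : Fin n) → Vars d (S i) → ℝ}
    (hp : ∀ i, IsPdf (p i)) (hpos : ∀ i, ∀ᵐ x, 0 < p i x) :
    ∃ c : ℝ, 0 ≤ c ∧ ∀ᵐ X : Vars d Finset.univ,
      ∏ i, mixed A p i (restrictVars (Finset.subset_univ (S i)) X)
        = c * ∏ i, p i (restrictVars (Finset.subset_univ (S i)) X) := by
  refine ⟨(∏ i, ∫ y, geomPool A p i y)⁻¹, inv_nonneg.2 (Finset.prod_nonneg fun i _ =>
    (integral_geomPool_pos hA0 hA1 hp hpos i).le), ?_⟩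
  filter_upwards [prod_geomPool hA1 hAs hp hpos] with X hX
  unfold mixed
  rw [Finset.prod_div_distrib, hX, div_eq_inv_mul]

/-- Up to normalization, the product of the agents' densities is the product of the priors times
the tempered likelihood ratios of all measurements. -/
theorem IsGenerated.exists_prod_eq (h : IsGenerated A q α p0 z p)
    (hq : ∀ i, Measurable (Function.uncurry (q i)))
    (hL : ∀ t i x, |Real.log (q i (z t i) x)| ≤ L)
    (hA0 : ∀ i j, 0 ≤ A i j) (hA1 : ∀ i, ∑ j, A i j = 1) (hAs : A.IsSymm)
    (hp0 : ∀ i, IsPdf (p0 i)) (hpos : ∀ i x, 0 < p0 i x) (xs : (i : Fin n) → Vars d (S i))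
    (t : ℕ) :
    ∃ c : ℝ, 0 ≤ c ∧ ∀ᵐ X : Vars d Finset.univ,
      ∏ i, p t i (restrictVars (Finset.subset_univ (S i)) X)
        = c * ∏ i, p0 i (restrictVars (Finset.subset_univ (S i)) X) *
          likelihoodRatio (q i) α (xs i) (fun s => z s i) t
            (restrictVars (Finset.subset_univ (S i)) X) := by
  induction t with
  | zero =>
    refine ⟨1, zero_le_one, ae_of_all _ fun X => ?_⟩
    simp [likelihoodRatio, h.1]
  | succ t ih =>
    obtain ⟨c, hc0, hc⟩ := ih
    obtain ⟨hpt, hpt0⟩ := h.isPdf_and_pos hq hL hA0 hA1 hp0 hpos t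
    obtain ⟨c', hc0', hc'⟩ := exists_prod_mixed_eq hA0 hA1 hAs hpt hpt0
    have hv := isPdf_mixed hA0 hA1 hpt hpt0
    have hnext : ∀ᵐ X : Vars d Finset.univ, ∀ i,
        p (t + 1) i (restrictVars (Finset.subset_univ (S i)) X)
          = temperedPosterior (α t) (q i (z t i)) (mixed A (p t) i)
            (restrictVars (Finset.subset_univ (S i)) X) :=
      ae_all_iff.2 fun i => (quasiMeasurePreserving_restrictVars _).ae (h.ae_eq hq hL (hv i))
    refine ⟨c' * c * ∏ i, (Real.exp (α t * Real.log (q i (z t i) (xs i))) /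
      ∫ y, mixed A (p t) i y * Real.exp (α t * Real.log (q i (z t i) y))), ?_, ?_⟩
    · refine mul_nonneg (mul_nonneg hc0' hc0) (Finset.prod_nonneg fun i _ =>
        div_nonneg (Real.exp_pos _).le (integral_nonneg fun y =>
          mul_nonneg ((hv i).2.2 y) (Real.exp_pos _).le))
    · filter_upwards [hc, hc', hnext] with X h1 h2 h3
      simp_rw [h3, temperedPosterior, likelihoodRatio, Finset.prod_range_succ, ← mul_assoc,
        mul_sub, Real.exp_sub, mul_div_assoc]
      simp_rw [likelihoodRatio, mul_sub, Real.exp_sub] at h1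
      rw [Finset.prod_mul_distrib, h2, h1, Finset.prod_mul_distrib (f := fun i => p0 i _ * _)]
      have : ∀ i, Real.exp (α t * Real.log (q i (z t i) (xs i))) ≠ 0 := fun i =>
        (Real.exp_pos _).ne'
      simp_rw [Finset.prod_div_distrib]
      have h4 : ∏ i, Real.exp (α t * Real.log (q i (z t i) (xs i))) ≠ 0 :=
        Finset.prod_ne_zero_iff.2 fun i _ => this i
      field_simp

theorem IsGenerated.exists_prod_mixed_eq (h : IsGenerated A q α p0 z p)
    (hq : ∀ i, Measurable (Function.uncurry (q i)))
    (hL : ∀ t i x, |Real.log (q i (z t i) x)| ≤ L)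
    (hA0 : ∀ i j, 0 ≤ A i j) (hA1 : ∀ i, ∑ j, A i j = 1) (hAs : A.IsSymm)
    (hp0 : ∀ i, IsPdf (p0 i)) (hpos : ∀ i x, 0 < p0 i x) (xs : (i : Fin n) → Vars d (S i))
    (t : ℕ) :
    ∃ c : ℝ, 0 ≤ c ∧ ∀ᵐ X : Vars d Finset.univ,
      ∏ i, mixed A (p t) i (restrictVars (Finset.subset_univ (S i)) X)
        = c * ∏ i, p0 i (restrictVars (Finset.subset_univ (S i)) X) *
          likelihoodRatio (q i) α (xs i) (fun s => z s i) t
            (restrictVars (Finset.subset_univ (S i)) X) := by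
  obtain ⟨hpt, hpt0⟩ := h.isPdf_and_pos hq hL hA0 hA1 hp0 hpos t
  obtain ⟨c, hc0, hc⟩ := h.exists_prod_eq hq hL hA0 hA1 hAs hp0 hpos xs t
  obtain ⟨c', hc0', hc'⟩ := DMSMD.exists_prod_mixed_eq hA0 hA1 hAs hpt hpt0
  refine ⟨c' * c, mul_nonneg hc0' hc0, ?_⟩
  filter_upwards [hc, hc'] with X h1 h2
  rw [h2, h1, mul_assoc]

/-- The mixed densities become the marginals of a joint density: a mirror step moves an estimate
by a distance that vanishes with the step size, and mixing contracts the distance. -/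
theorem IsGenerated.tendsto_tvDist (h : IsGenerated A q α p0 z p)
    (hq : ∀ i, Measurable (Function.uncurry (q i)))
    (hL : ∀ t i x, |Real.log (q i (z t i) x)| ≤ L)
    (hA0 : ∀ i j, 0 ≤ A i j) (hA1 : ∀ i, ∑ j, A i j = 1)
    (hp0 : ∀ i, IsPdf (p0 i)) (hpos : ∀ i x, 0 < p0 i x) (hα : Tendsto α atTop (𝓝 0))
    {σ c : ℝ} (hσ : 0 < σ ∧ σ < 1) {pbar : ℕ → Vars d Finset.univ → ℝ}
    (hpdf : ∀ t, IsPdf (pbar t))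
    (hcontr : ∀ t i, tvDist (mixed A (p t) i) (marginal (S i) (pbar t))
      ≤ σ * tvDist (p t i) (marginal (S i) (pbar t)))
    (hdrift : ∀ t, tvDist (pbar t) (pbar (t + 1)) ≤ (c - 1) * α t * L / 2) (i : Fin n) :
    Tendsto (fun t => tvDist (mixed A (p t) i) (marginal (S i) (pbar t))) atTop (𝓝 0) := by
  have hpt := h.isPdf_and_pos hq hL hA0 hA1 hp0 hpos
  have hv := fun t => isPdf_mixed hA0 hA1 (hpt t).1 (hpt t).2 i
  have hm := fun t => (hpdf t).marginal (Finset.subset_univ (S i))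
  have key : Tendsto (fun t => tvDist (p t i) (marginal (S i) (pbar t))) atTop (𝓝 0) := by
    refine tendsto_zero_of_le_mul_add (σ := σ)
      (b := fun t => Real.exp (2 * (|α t| * L)) - 1 + (c - 1) * α t * L / 2)
      hσ.1.le hσ.2 (fun t => tvDist_nonneg) ?_ fun t => ?_
    · have : Continuous fun a : ℝ => Real.exp (2 * (|a| * L)) - 1 + (c - 1) * a * L / 2 := by
        fun_prop
      simpa [Function.comp_def] using (this.tendsto 0).comp hα
    · have h1 : tvDist (p (t + 1) i) (mixed A (p t) i) ≤ Real.exp (2 * (|α t| * L)) - 1 := by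
        have hlm : Measurable (q i (z t i)) := (hq i).comp measurable_prodMk_left
        rw [tvDist_comm, tvDist_eq (hv t) ((hpt (t + 1)).1 i),
          pdfMeasure_congr (h.ae_eq hq hL (hv t)),
          ← tvDist_eq (hv t) (isPdf_temperedPosterior (hv t) hlm (hL t i))]
        exact tvDist_temperedPosterior_le (hv t) hlm (hL t i)
      have h2 := tvDist_triangle ((hpt (t + 1)).1 i) (hv t) (hm (t + 1))
      have h3 := tvDist_triangle (hv t) (hm t) (hm (t + 1))
      have h4 := (tvDist_marginal_le (Finset.subset_univ (S i)) (hpdf t) (hpdf (t + 1))).trans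
        (hdrift t)
      have h5 := hcontr t i
      linarith
  refine squeeze_zero (fun t => tvDist_nonneg) (fun t => hcontr t i) ?_
  simpa using key.const_mul σ

end Trajectory

section Concentration

variable {n m : ℕ} {d : Fin m → ℕ} {ℓ : Fin n → ℕ} {S : Fin n → Finset (Fin m)}
  {A : Matrix (Fin n) (Fin n) ℝ} {q : (i : Fin n) → (Fin (ℓ i) → ℝ) → Vars d (S i) → ℝ}
  {α : ℕ → ℝ} {p0 : (i : Fin n) → Vars d (S i) → ℝ} {z : ℕ → (i : Fin n) → Fin (ℓ i) → ℝ}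
  {p : ℕ → (i : Fin n) → Vars d (S i) → ℝ} {L : ℝ}

/-- A set that the non-distributed tempered posterior of agent `i` (the prior of agent `i` times
its own likelihood ratios) forgets is also forgotten by the mixed density of agent `i`. -/
theorem IsGenerated.tendsto_measureReal_mixed (h : IsGenerated A q α p0 z p)
    (hq : ∀ i, Measurable (Function.uncurry (q i)))
    (hL : ∀ t i x, |Real.log (q i (z t i) x)| ≤ L)
    (hA0 : ∀ i j, 0 ≤ A i j) (hA1 : ∀ i, ∑ j, A i j = 1) (hAs : A.IsSymm)
    (hp0 : ∀ i, IsPdf (p0 i)) (hpos : ∀ i x, 0 < p0 i x)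
    {pbar : ℕ → Vars d Finset.univ → ℝ} (hpdf : ∀ t, IsPdf (pbar t))
    (htv : ∀ i, Tendsto (fun t => tvDist (mixed A (p t) i) (marginal (S i) (pbar t)))
      atTop (𝓝 0)) (xs : (i : Fin n) → Vars d (S i))
    {r : Vars d Finset.univ → ℝ} (hr : IsPdf r)
    (hone : ∀ᵐ X ∂pdfMeasure r, ∀ t i, likelihoodRatio (q i) α (xs i) (fun s => z s i) t
      (restrictVars (Finset.subset_univ (S i)) X) = 1) {M : ℝ}
    (hint : ∀ t i, Integrable fun x => p0 i x *
      likelihoodRatio (q i) α (xs i) (fun s => z s i) t x)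
    (hM : ∀ t i, ∫ x, p0 i x * likelihoodRatio (q i) α (xs i) (fun s => z s i) t x ≤ M)
    (i : Fin n) {B : Set (Vars d (S i))} (hB : MeasurableSet B)
    (hlim : Tendsto (fun t => ∫ x in B, p0 i x *
      likelihoodRatio (q i) α (xs i) (fun s => z s i) t x) atTop (𝓝 0)) :
    Tendsto (fun t => (pdfMeasure (mixed A (p t) i)).real B) atTop (𝓝 0) := by
  have hpt := h.isPdf_and_pos hq hL hA0 hA1 hp0 hpos
  have hv := fun t => isPdf_mixed hA0 hA1 (hpt t).1 (hpt t).2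
  have hvpos := fun t => mixed_pos hA0 hA1 (hpt t).1 (hpt t).2
  obtain ⟨K, hK⟩ := exists_bound_of_prod_eq hp0 (fun i => ae_of_all _ (hpos i)) hr
  choose c hc0 hc using fun t => h.exists_prod_mixed_eq hq hL hA0 hA1 hAs hp0 hpos xs t
  have hcK : ∀ t, c t ≤ K := fun t => by
    refine hK _ (hv t) _ ?_
    filter_upwards [pdfMeasure_absolutelyContinuous.ae_le (hc t), hone] with X h1 h2
    rw [h1]
    simp only [h2, mul_one]
  have he : Tendsto (fun t => ∑ j, tvDist (mixed A (p t) j) (marginal (S j) (pbar t)))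
      atTop (𝓝 0) := by
    simpa using tendsto_finsetSum Finset.univ fun j _ => htv j
  have hb0 : ∀ t i x, 0 ≤ p0 i x * likelihoodRatio (q i) α (xs i) (fun s => z s i) t x :=
    fun t i x => mul_nonneg (hpos i x).le (likelihoodRatio_pos _ _ _ _ _ _).le
  -- the bound for a fixed threshold `R`
  have hbound : ∀ R : ℝ, 0 < R → ∀ t, (pdfMeasure (mixed A (p t) i)).real B
      ≤ n * (M / R + ∑ j, tvDist (mixed A (p t) j) (marginal (S j) (pbar t)))
        + ∑ j, tvDist (mixed A (p t) j) (marginal (S j) (pbar t))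
        + K * R ^ (n - 1) * ∫ x in B, p0 i x *
          likelihoodRatio (q i) α (xs i) (fun s => z s i) t x := fun R hR t => by
    refine (measureReal_le_of_prod_eq (hv t) (hvpos t) (hint t) (hb0 t) (hc0 t) (hc t) (hpdf t)
      (fun j => Finset.single_le_sum
        (f := fun j => tvDist (mixed A (p t) j) (marginal (S j) (pbar t)))
        (fun j _ => tvDist_nonneg) (Finset.mem_univ j)) (hM t) hR i
      hB.nullMeasurableSet).trans ?_
    gcongr
    · exact setIntegral_nonneg hB fun x _ => hb0 t i x
    · exact hcK t
  refine tendsto_order.2 ⟨fun a ha => .of_forall fun t => ha.trans_le measureReal_nonneg,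
    fun ε hε => ?_⟩
  have hRlim : Tendsto (fun R : ℝ => n * (M / R)) atTop (𝓝 0) := by
    simpa using (tendsto_const_nhds (x := M)).div_atTop tendsto_id |>.const_mul (n : ℝ)
  obtain ⟨R, hRε, hR⟩ := ((hRlim.eventually_lt_const hε).and (eventually_gt_atTop 0)).exists
  have htot := (((tendsto_const_nhds (x := M / R)).add he).const_mul (n : ℝ)).add he |>.add
    (hlim.const_mul (K * R ^ (n - 1)))
  simp only [add_zero, mul_zero] at htot
  filter_upwards [htot.eventually_lt_const hRε] with t ht
  exact (hbound R hR t).trans_lt ht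

end Concentration

/-! ### Densities concentrated on a set of parameters -/

section Closing

/-- Conditioning a density `v` on a set `B` costs the divergence `-log v(B)`. -/
theorem KL_indicator_div {E : Type*} [MeasureSpace E] {v : E → ℝ} (hv : IsPdf v) {B : Set E}
    (hB : NullMeasurableSet B) (hvB : 0 < (pdfMeasure v).real B) :
    KL (fun x => B.indicator v x / (pdfMeasure v).real B) v
      = ENNReal.ofReal (-Real.log ((pdfMeasure v).real B)) := by
  have := hv.isProbabilityMeasure
  set b := (pdfMeasure v).real B with hb
  set μ := pdfMeasure (fun x => B.indicator v x / b) with hμ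
  have hBv : NullMeasurableSet B (pdfMeasure v) := hB.mono_ac pdfMeasure_absolutelyContinuous
  have hgm : AEMeasurable (B.indicator fun _ => ENNReal.ofReal b⁻¹) (volume : Measure E) :=
    aemeasurable_const.indicator₀ hB
  have hμeq : μ = (pdfMeasure v).withDensity (B.indicator fun _ => ENNReal.ofReal b⁻¹) := by
    rw [hμ, pdfMeasure, pdfMeasure, ← withDensity_mul₀ (aemeasurable_ofReal hv.1) hgm]
    congr 1
    ext x
    by_cases hx : x ∈ B
    · simp only [Set.indicator_of_mem hx, Pi.mul_apply]
      rw [← ENNReal.ofReal_mul (hv.2.2 x), div_eq_mul_inv]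
    · simp [Set.indicator_of_notMem hx]
  have hμuniv : μ Set.univ = 1 := by
    rw [hμeq, withDensity_apply _ .univ, Measure.restrict_univ, lintegral_indicator₀ hBv,
      lintegral_const, Measure.restrict_apply .univ, Set.univ_inter, ← ofReal_measureReal,
      ← hb, ← ENNReal.ofReal_mul (inv_pos.2 hvB).le, inv_mul_cancel₀ hvB.ne', ENNReal.ofReal_one]
  have : IsProbabilityMeasure μ := ⟨hμuniv⟩
  have hac : μ ≪ pdfMeasure v := hμeq ▸ withDensity_absolutelyContinuous _ _
  have hmem : ∀ᵐ x ∂μ, x ∈ B := by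
    rw [hμeq, ae_withDensity_iff' (hgm.mono_ac pdfMeasure_absolutelyContinuous)]
    refine ae_of_all _ fun x hx => ?_
    by_contra hxB
    exact hx (Set.indicator_of_notMem hxB _)
  have hllr : llr μ (pdfMeasure v) =ᵐ[μ] fun _ => -Real.log b := by
    have h1 : μ.rnDeriv (pdfMeasure v)
        =ᵐ[pdfMeasure v] B.indicator fun _ => ENNReal.ofReal b⁻¹ := by
      rw [hμeq]
      exact Measure.rnDeriv_withDensity₀ _ (hgm.mono_ac pdfMeasure_absolutelyContinuous)
    filter_upwards [hac.ae_le h1, hmem] with x hx hxB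
    rw [llr, hx, Set.indicator_of_mem hxB, ENNReal.toReal_ofReal (inv_pos.2 hvB).le, Real.log_inv]
  have hne : KL (fun x => B.indicator v x / b) v ≠ ⊤ :=
    InformationTheory.klDiv_ne_top hac ((integrable_const _).congr hllr.symm)
  rw [← ENNReal.ofReal_toReal hne, KL, InformationTheory.toReal_klDiv_of_measure_eq hac (by simp),
    integral_congr_ae hllr]
  simp

variable {m : ℕ} {d : Fin m → ℕ} {s : Finset (Fin m)}

/-- A density `v` of some of the variables extends to a joint density with support in that of a
given function `u`, after conditioning on the set where the marginal of `u` does not vanish: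
the other variables are drawn from the conditional density of `u`. -/
theorem exists_extension {v : Vars d s → ℝ} (hv : IsPdf v) {u : Vars d Finset.univ → ℝ}
    (hu : Integrable u) (hu0 : ∀ x, 0 ≤ u x)
    (hB : 0 < (pdfMeasure v).real {x | marginal s u x ≠ 0}) :
    ∃ r : Vars d Finset.univ → ℝ, IsPdf r ∧ (∀ X, u X = 0 → r X = 0) ∧
      KL (marginal s r) v
        = ENNReal.ofReal (-Real.log ((pdfMeasure v).real {x | marginal s u x ≠ 0})) := by
  set B := {x | marginal s u x ≠ 0} with hBdef
  set b := (pdfMeasure v).real B with hb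
  have hum := integrable_marginal (Finset.subset_univ s) hu
  have hum0 : ∀ y, 0 ≤ marginal s u y := marginal_nonneg hu0
  have hBm : NullMeasurableSet B :=
    hum.aemeasurable.nullMeasurableSet_preimage (measurableSet_singleton (0 : ℝ)).compl
  set f : Vars d s → ℝ := fun x => v x / marginal s u x / b with hf
  have hf0 : ∀ x, 0 ≤ f x := fun x => div_nonneg (div_nonneg (hv.2.2 x) (hum0 x)) hB.le
  have hfm : AEMeasurable f := (hv.1.aemeasurable.div hum.aemeasurable).div_const b
  have hfu : ∀ x, marginal s u x * f x = B.indicator v x / b := fun x => by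
    by_cases hx : marginal s u x = 0
    · have : x ∉ B := fun h => h hx
      simp [hx, this]
    · have : x ∈ B := hx
      simp only [hf, Set.indicator_of_mem this]
      field_simp
  let r : Vars d Finset.univ → ℝ := fun X => u X * f (restrictVars (Finset.subset_univ s) X)
  have hr0 : ∀ X, 0 ≤ r X := fun X => mul_nonneg (hu0 X) (hf0 _)
  have hrm : AEMeasurable r := hu.aemeasurable.mul
    (hfm.comp_quasiMeasurePreserving (quasiMeasurePreserving_restrictVars _))
  have hlint : ∫⁻ X, ENNReal.ofReal (r X) = 1 := by
    have h1 := lintegral_mul_restrictVars (Finset.subset_univ s) hu hu0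
      (f := fun y => ENNReal.ofReal (f y)) hfm.ennreal_ofReal
    simp only [← ENNReal.ofReal_mul (hu0 _), ← ENNReal.ofReal_mul (hum0 _)] at h1
    rw [h1]
    have h2 : Integrable (fun x => B.indicator v x / b) :=
      (hv.1.indicator₀ hBm).div_const b
    simp only [hfu]
    rw [← ofReal_integral_eq_lintegral_ofReal h2 (ae_of_all _ fun x =>
      div_nonneg (Set.indicator_nonneg (fun y _ => hv.2.2 y) x) hB.le), integral_div,
      integral_indicator₀ hBm, ← pdfMeasure_real_apply hv.1 hv.2.2 hBm, ← hb, div_self hB.ne',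
      ENNReal.ofReal_one]
  have hri : Integrable r := by
    refine ⟨hrm.aestronglyMeasurable, ?_⟩
    rw [hasFiniteIntegral_iff_ofReal (ae_of_all _ hr0), hlint]
    exact ENNReal.one_lt_top
  refine ⟨r, ⟨hri, ?_, hr0⟩, fun X hX => by simp [r, hX], ?_⟩
  · rw [integral_eq_lintegral_of_nonneg_ae (ae_of_all _ hr0) hrm.aestronglyMeasurable, hlint,
      ENNReal.toReal_one]
  · have : marginal s r = fun x => B.indicator v x / b := by
      ext y
      rw [← hfu y]
      simp only [marginal, r, restrictVars_glueVars]
      exact integral_mul_const _ _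
    rw [this]
    exact KL_indicator_div hv hBm hB

/-- If densities `v t i` concentrate on the sets `Θ i` and are asymptotically the marginals of
joint densities, then they come close, in divergence, to marginals of joint densities that live
on the parameters whose restrictions belong to all the `Θ i`. -/
theorem eventually_mem_partialNeighborhood {n : ℕ} {S : Fin n → Finset (Fin m)}
    {Θ : (i : Fin n) → Set (Vars d (S i))} (hΘ : ∀ i, MeasurableSet (Θ i))
    {F : Set (Vars d Finset.univ → ℝ)}
    (hF : ∀ r, IsPdf r → (∀ X, (∃ i, restrictVars (Finset.subset_univ (S i)) X ∉ Θ i) → r X = 0) →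
      r ∈ F)
    {v : ℕ → (i : Fin n) → Vars d (S i) → ℝ} (hv : ∀ t i, IsPdf (v t i))
    {pbar : ℕ → Vars d Finset.univ → ℝ} (hpdf : ∀ t, IsPdf (pbar t))
    (htv : ∀ i, Tendsto (fun t => tvDist (v t i) (marginal (S i) (pbar t))) atTop (𝓝 0))
    (hlim : ∀ i, Tendsto (fun t => (pdfMeasure (v t i)).real (Θ i)ᶜ) atTop (𝓝 0))
    (i : Fin n) {ε : ℝ} (hε : 0 < ε) :
    ∀ᶠ t in atTop, v t i ∈ partialNeighborhood (S i) F ε := by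
  have := fun t i => (hv t i).isProbabilityMeasure
  have := fun t => (hpdf t).isProbabilityMeasure
  have hm := fun t i => (hpdf t).marginal (Finset.subset_univ (S i))
  set T : Set (Vars d Finset.univ) :=
    ⋂ i, restrictVars (Finset.subset_univ (S i)) ⁻¹' Θ i with hT
  have hTm : MeasurableSet T :=
    MeasurableSet.iInter fun i => measurable_restrictVars _ (hΘ i)
  obtain ⟨γ, hγ0, hγm, hγ⟩ := exists_pos_lintegral_lt_of_sigmaFinite
    (volume : Measure (Vars d Finset.univ)) one_ne_zero
  have hγi : Integrable (fun X => (γ X : ℝ)) := by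
    refine ⟨hγm.coe_nnreal_real.aestronglyMeasurable, ?_⟩
    rw [hasFiniteIntegral_iff_ofReal (ae_of_all _ fun X => (γ X).coe_nonneg)]
    simpa using hγ.trans ENNReal.one_lt_top
  set u : Vars d Finset.univ → ℝ := T.indicator fun X => (γ X : ℝ) with hu
  have hui : Integrable u := hγi.indicator hTm
  have hu0 : ∀ X, 0 ≤ u X := fun X => Set.indicator_nonneg (fun X _ => (γ X).coe_nonneg) X
  set B : Set (Vars d (S i)) := {x | marginal (S i) u x ≠ 0} with hB
  have hBm : NullMeasurableSet B :=
    (integrable_marginal (Finset.subset_univ (S i)) hui).aemeasurable.nullMeasurableSet_preimage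
      (measurableSet_singleton (0 : ℝ)).compl
  -- almost every point of `T` restricts to a point of `B`
  have hTB : ∀ᵐ X, X ∈ T → restrictVars (Finset.subset_univ (S i)) X ∈ B := by
    have h1 : ∀ᵐ y ∂pdfMeasure (marginal (S i) u), y ∈ B := by
      rw [pdfMeasure, ae_withDensity_iff' (aemeasurable_ofReal
        (integrable_marginal (Finset.subset_univ (S i)) hui))]
      exact ae_of_all _ fun y hy hy0 => hy (by rw [hy0, ENNReal.ofReal_zero])
    rw [← map_restrictVars_pdfMeasure (Finset.subset_univ _) hui hu0] at h1
    have h2 := ae_of_ae_map (measurable_restrictVars _).aemeasurable h1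
    rw [pdfMeasure, ae_withDensity_iff' (aemeasurable_ofReal hui)] at h2
    filter_upwards [h2] with X hX hXT
    refine hX ?_
    simpa [u, Set.indicator_of_mem hXT] using (hγ0 X).ne'
  have hbarT : Tendsto (fun t => (pdfMeasure (pbar t)).real Tᶜ) atTop (𝓝 0) := by
    have hsum : Tendsto (fun t => ∑ j, (tvDist (v t j) (marginal (S j) (pbar t))
        + (pdfMeasure (v t j)).real (Θ j)ᶜ)) atTop (𝓝 0) := by
      simpa using tendsto_finsetSum Finset.univ fun j _ => (htv j).add (hlim j)
    refine squeeze_zero (fun t => measureReal_nonneg) (fun t => ?_) hsum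
    have hTc : Tᶜ = ⋃ j, restrictVars (Finset.subset_univ (S j)) ⁻¹' (Θ j)ᶜ := by
      rw [hT, Set.compl_iInter]; rfl
    rw [hTc]
    refine (measureReal_iUnion_fintype_le _).trans (Finset.sum_le_sum fun j _ => ?_)
    rw [measureReal_preimage_restrictVars _ (hpdf t) (hΘ j).compl.nullMeasurableSet]
    have h1 := abs_le.1 (abs_measureReal_sub_le_tvDist (hv t j) (hm t j)
      (hΘ j).compl.nullMeasurableSet)
    linarith
  have hvB : Tendsto (fun t => (pdfMeasure (v t i)).real Bᶜ) atTop (𝓝 0) := by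
    refine squeeze_zero (fun t => measureReal_nonneg) (fun t => ?_)
      (by simpa using (htv i).add hbarT)
    have h1 := abs_le.1 (abs_measureReal_sub_le_tvDist (hv t i) (hm t i) hBm.compl)
    have h2 : (pdfMeasure (marginal (S i) (pbar t))).real Bᶜ ≤ (pdfMeasure (pbar t)).real Tᶜ := by
      rw [← measureReal_preimage_restrictVars (Finset.subset_univ _) (hpdf t) hBm.compl]
      refine ENNReal.toReal_mono (measure_ne_top _ _)
        (measure_mono_ae (pdfMeasure_absolutelyContinuous.ae_le ?_))
      filter_upwards [hTB] with X hX hXB hXT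
      exact hXB (hX hXT)
    linarith
  have hexp : 0 < 1 - Real.exp (-ε) := by
    have : Real.exp (-ε) < 1 := by rw [Real.exp_lt_one_iff]; linarith
    linarith
  filter_upwards [hvB.eventually_lt_const hexp] with t ht
  rw [probReal_compl_eq_one_sub₀ (hBm.mono_ac pdfMeasure_absolutelyContinuous)] at ht
  have hlt : Real.exp (-ε) < (pdfMeasure (v t i)).real B := by linarith
  obtain ⟨r, hr, hru, hKL⟩ := exists_extension (hv t i) hui hu0 ((Real.exp_pos _).trans hlt)
  refine ⟨hv t i, r, hF r hr fun X ⟨j, hj⟩ => hru X ?_, ?_⟩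
  · exact Set.indicator_of_notMem (fun hX => hj (Set.mem_iInter.1 hX j)) _
  · rw [hKL]
    refine ENNReal.ofReal_le_ofReal ?_
    have := (Real.lt_log_iff_exp_lt ((Real.exp_pos _).trans hlt)).2 hlt
    linarith

end Closing

/-! ### Mixtures of products of independent factors -/

section ProductMixtures

variable {Y E : Type*} [MeasurableSpace Y] [MeasurableSpace E]

theorem measurable_lintegral_prod_range {Ω : Type*} [MeasurableSpace Ω] {Z : ℕ → Ω → Y}
    {g : ℕ → Y → E → ℝ≥0∞} (hg : ∀ s, Measurable (Function.uncurry (g s))) (μ : Measure E)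
    [SFinite μ] {t : ℕ} (hZ : ∀ s < t, Measurable (Z s)) :
    Measurable fun ω => ∫⁻ x, ∏ s ∈ Finset.range t, g s (Z s ω) x ∂μ := by
  refine Measurable.lintegral_prod_right'
    (f := fun a : Ω × E => ∏ s ∈ Finset.range t, g s (Z s a.1) a.2) ?_
  refine Finset.measurable_fun_prod _ fun s hs => ?_
  exact (hg s).comp (((hZ s (Finset.mem_range.1 hs)).comp measurable_fst).prodMk measurable_snd)

variable {Ω : Type*} [mΩ : MeasurableSpace Ω] {P : Measure Ω}
  {Z : ℕ → Ω → Y} {g : ℕ → Y → E → ℝ≥0∞}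

/-- The information in the variables `Z s` with `s < t`. -/
def strictPast (hZ : ∀ s, Measurable (Z s)) : Filtration ℕ mΩ where
  seq t := ⨆ s ∈ Set.Iio t, MeasurableSpace.comap (Z s) inferInstance
  mono' _ _ h := biSup_mono fun _ hs => lt_of_lt_of_le hs h
  le' _ := iSup₂_le fun s _ => (hZ s).comap_le

theorem measurable_strictPast (hZ : ∀ s, Measurable (Z s)) {s t : ℕ} (h : s < t) :
    Measurable[strictPast hZ t] (Z s) :=
  measurable_iff_comap_le.2 (le_iSup₂_of_le (f := fun s (_ : s ∈ Set.Iio t) =>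
    MeasurableSpace.comap (Z s) inferInstance) s h le_rfl)

theorem indep_strictPast (hZ : ∀ s, Measurable (Z s)) (hind : iIndepFun Z P) (t : ℕ) :
    Indep (strictPast hZ t) (MeasurableSpace.comap (Z t) inferInstance) P := by
  have := indep_iSup_of_disjoint (fun s => (hZ s).comap_le) hind.iIndep
    (S := Set.Iio t) (T := {t}) (by simp)
  simpa [strictPast] using this

/-- Conditionally on the past, the next factor averages out to its mean. -/
theorem setLIntegral_prod_succ_eq (hZ : ∀ s, Measurable (Z s)) (hind : iIndepFun Z P)
    (hg : ∀ s, Measurable (Function.uncurry (g s))) (t : ℕ) (x : E) {F : Set Ω}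
    (hF : MeasurableSet[strictPast hZ t] F) :
    ∫⁻ ω in F, ∏ s ∈ Finset.range (t + 1), g s (Z s ω) x ∂P
      = (∫⁻ ω in F, ∏ s ∈ Finset.range t, g s (Z s ω) x ∂P) * ∫⁻ ω, g t (Z t ω) x ∂P := by
  have hF' : MeasurableSet F := (strictPast hZ).le t _ hF
  have hgx : ∀ s, Measurable fun y => g s y x := fun s => (hg s).comp measurable_prodMk_right
  have h1 : Measurable[strictPast hZ t]
      (F.indicator fun ω => ∏ s ∈ Finset.range t, g s (Z s ω) x) := by
    refine Measurable.indicator ?_ hF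
    exact Finset.measurable_fun_prod _ fun s hs =>
      (hgx s).comp (measurable_strictPast hZ (Finset.mem_range.1 hs))
  have h2 : Measurable[MeasurableSpace.comap (Z t) inferInstance] fun ω => g t (Z t ω) x :=
    (hgx t).comp (comap_measurable (Z t))
  rw [← lintegral_indicator hF', ← lintegral_indicator hF',
    ← lintegral_mul_eq_lintegral_mul_lintegral_of_independent_measurableSpace
      ((strictPast hZ).le t) (hZ t).comap_le (indep_strictPast hZ hind t) h1 h2]
  refine lintegral_congr fun ω => ?_
  by_cases hω : ω ∈ F
  · simp [Set.indicator_of_mem hω, Finset.prod_range_succ]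
  · simp [Set.indicator_of_notMem hω]

theorem lintegral_prod_range_eq [IsProbabilityMeasure P]
    (hZ : ∀ s, Measurable (Z s)) (hind : iIndepFun Z P)
    (hg : ∀ s, Measurable (Function.uncurry (g s))) (t : ℕ) (x : E) :
    ∫⁻ ω, ∏ s ∈ Finset.range t, g s (Z s ω) x ∂P
      = ∏ s ∈ Finset.range t, ∫⁻ ω, g s (Z s ω) x ∂P := by
  induction t with
  | zero => simp
  | succ t ih =>
    have h := setLIntegral_prod_succ_eq hZ hind hg t x (F := Set.univ) .univ
    rw [Measure.restrict_univ] at h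
    rw [h, ih, Finset.prod_range_succ]

theorem lintegral_lintegral_prod_range_eq [IsProbabilityMeasure P]
    (hZ : ∀ s, Measurable (Z s)) (hind : iIndepFun Z P)
    (hg : ∀ s, Measurable (Function.uncurry (g s))) (μ : Measure E) [SFinite μ] (t : ℕ) :
    ∫⁻ ω, ∫⁻ x, ∏ s ∈ Finset.range t, g s (Z s ω) x ∂μ ∂P
      = ∫⁻ x, ∏ s ∈ Finset.range t, ∫⁻ ω, g s (Z s ω) x ∂P ∂μ := by
  rw [lintegral_lintegral_swap]
  · exact lintegral_congr fun x => lintegral_prod_range_eq hZ hind hg t x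
  · exact (Finset.measurable_fun_prod _ fun s _ =>
      (hg s).comp (((hZ s).comp measurable_fst).prodMk measurable_snd)).aemeasurable

/-- The `μ`-mixture of the products of independent nonnegative factors of mean at most one is a
nonnegative supermartingale, hence converges almost surely. -/
theorem ae_tendsto_lintegral_prod_range [IsProbabilityMeasure P]
    (hZ : ∀ s, Measurable (Z s)) (hind : iIndepFun Z P)
    (hg : ∀ s, Measurable (Function.uncurry (g s))) (μ : Measure E) [IsFiniteMeasure μ]
    (hone : ∀ s x, ∫⁻ ω, g s (Z s ω) x ∂P ≤ 1) :
    ∀ᵐ ω ∂P, (∀ t, ∫⁻ x, ∏ s ∈ Finset.range t, g s (Z s ω) x ∂μ ≠ ⊤) ∧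
      ∃ w : ℝ, Tendsto (fun t => (∫⁻ x, ∏ s ∈ Finset.range t, g s (Z s ω) x ∂μ).toReal)
        atTop (𝓝 w) := by
  set W : ℕ → Ω → ℝ≥0∞ := fun t ω => ∫⁻ x, ∏ s ∈ Finset.range t, g s (Z s ω) x ∂μ with hW
  have hWm : ∀ t, Measurable[strictPast hZ t] (W t) := fun t =>
    @measurable_lintegral_prod_range Y E _ _ Ω (strictPast hZ t) Z g hg μ _ t
      fun s hs => measurable_strictPast hZ hs
  have hWm' : ∀ t, Measurable (W t) := fun t => (hWm t).mono ((strictPast hZ).le t) le_rfl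
  have hWle : ∀ t, ∫⁻ ω, W t ω ∂P ≤ μ Set.univ := fun t => by
    rw [lintegral_lintegral_prod_range_eq hZ hind hg]
    calc _ ≤ ∫⁻ _x, 1 ∂μ := lintegral_mono fun x => Finset.prod_le_one' fun s _ => hone s x
      _ = μ Set.univ := by simp
  have hWtop : ∀ t, ∫⁻ ω, W t ω ∂P ≠ ⊤ := fun t =>
    ((hWle t).trans_lt (measure_lt_top _ _)).ne
  have hWfin : ∀ᵐ ω ∂P, ∀ t, W t ω < ⊤ := ae_all_iff.2 fun t =>
    ae_lt_top (hWm' t) (hWtop t)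
  have hWint : ∀ t, Integrable (fun ω => (W t ω).toReal) P := fun t =>
    integrable_toReal_of_lintegral_ne_top (hWm' t).aemeasurable (hWtop t)
  have hset : ∀ t F, ∫ ω in F, (W t ω).toReal ∂P = (∫⁻ ω in F, W t ω ∂P).toReal := fun t F =>
    integral_toReal (hWm' t).aemeasurable (ae_restrict_of_ae (hWfin.mono fun ω h => h t))
  have hsub : Submartingale (fun t ω => -(W t ω).toReal) (strictPast hZ) P := by
    refine submartingale_of_setIntegral_le_succ (fun t => ?_) (fun t => (hWint t).neg)
      fun t F hF => ?_
    · exact (Measurable.stronglyMeasurable (hWm t).ennreal_toReal).neg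
    · have hF' : MeasurableSet F := (strictPast hZ).le t _ hF
      rw [integral_neg, integral_neg, neg_le_neg_iff, hset, hset]
      refine ENNReal.toReal_mono
        ((setLIntegral_le_lintegral F _).trans_lt (hWtop t).lt_top).ne ?_
      have hjm : ∀ t, Measurable fun a : Ω × E =>
          ∏ s ∈ Finset.range t, g s (Z s a.1) a.2 := fun t =>
        Finset.measurable_fun_prod _ fun s _ =>
          (hg s).comp (((hZ s).comp measurable_fst).prodMk measurable_snd)
      have hswap : ∀ t, ∫⁻ ω in F, W t ω ∂P
          = ∫⁻ x, ∫⁻ ω in F, ∏ s ∈ Finset.range t, g s (Z s ω) x ∂P ∂μ := fun t =>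
        lintegral_lintegral_swap (hjm t).aemeasurable
      rw [hswap, hswap]
      refine lintegral_mono fun x => ?_
      rw [setLIntegral_prod_succ_eq hZ hind hg t x hF]
      exact mul_le_of_le_one_right' (hone t x)
  have hbdd : ∀ t, eLpNorm (fun ω => -(W t ω).toReal) 1 P
      ≤ ((μ Set.univ).toNNReal : ℝ≥0∞) := fun t => by
    rw [ENNReal.coe_toNNReal (measure_ne_top _ _), eLpNorm_one_eq_lintegral_enorm]
    refine (lintegral_mono fun ω => ?_).trans (hWle t)
    rw [enorm_neg, Real.enorm_of_nonneg ENNReal.toReal_nonneg]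
    exact ENNReal.ofReal_toReal_le
  filter_upwards [hsub.exists_ae_tendsto_of_bdd hbdd, hWfin] with ω hω hfin
  obtain ⟨w, hw⟩ := hω
  exact ⟨fun t => (hfin t).ne, -w, by simpa using hw.neg⟩

/-- If the products of the means tend to zero for almost every value of the mixing variable, so
does, almost surely, the mixture of the products: its limit has mean zero by Fatou's lemma. -/
theorem ae_tendsto_zero_lintegral_prod_range [IsProbabilityMeasure P]
    (hZ : ∀ s, Measurable (Z s)) (hind : iIndepFun Z P)
    (hg : ∀ s, Measurable (Function.uncurry (g s))) (μ : Measure E) [IsFiniteMeasure μ]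
    (hone : ∀ s x, ∫⁻ ω, g s (Z s ω) x ∂P ≤ 1)
    (hzero : ∀ᵐ x ∂μ, Tendsto (fun t => ∏ s ∈ Finset.range t, ∫⁻ ω, g s (Z s ω) x ∂P)
      atTop (𝓝 0)) :
    ∀ᵐ ω ∂P, Tendsto (fun t => (∫⁻ x, ∏ s ∈ Finset.range t, g s (Z s ω) x ∂μ).toReal)
      atTop (𝓝 0) := by
  have hWm' : ∀ t, Measurable fun ω => ∫⁻ x, ∏ s ∈ Finset.range t, g s (Z s ω) x ∂μ := fun t =>
    measurable_lintegral_prod_range hg μ fun s _ => hZ s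
  have hmean : Tendsto (fun t => ∫⁻ ω, ∫⁻ x, ∏ s ∈ Finset.range t, g s (Z s ω) x ∂μ ∂P)
      atTop (𝓝 0) := by
    simp_rw [lintegral_lintegral_prod_range_eq hZ hind hg]
    have hm : ∀ t, Measurable fun x => ∏ s ∈ Finset.range t, ∫⁻ ω, g s (Z s ω) x ∂P := fun t =>
      Finset.measurable_fun_prod _ fun s _ => Measurable.lintegral_prod_left'
        (f := fun a : Ω × E => g s (Z s a.1) a.2)
        ((hg s).comp (((hZ s).comp measurable_fst).prodMk measurable_snd))
    have := tendsto_lintegral_of_dominated_convergence (μ := μ) (fun _ => (1 : ℝ≥0∞)) hm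
      (fun t => ae_of_all _ fun x => Finset.prod_le_one' fun s _ => hone s x) (by simp) hzero
    simpa using this
  have hlim := lintegral_liminf_le (μ := P) (u := atTop) hWm'
  rw [hmean.liminf_eq, nonpos_iff_eq_zero, lintegral_eq_zero_iff (.liminf hWm')] at hlim
  filter_upwards [ae_tendsto_lintegral_prod_range hZ hind hg μ hone, hlim] with ω hω h0
  obtain ⟨hfin, w, hw⟩ := hω
  have h1 : Tendsto (fun t => ∫⁻ x, ∏ s ∈ Finset.range t, g s (Z s ω) x ∂μ) atTop
      (𝓝 (ENNReal.ofReal w)) := by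
    simpa only [ENNReal.ofReal_toReal (hfin _)] using ENNReal.tendsto_ofReal hw
  have hw0 : 0 ≤ w := ge_of_tendsto' hw fun t => ENNReal.toReal_nonneg
  rw [h1.liminf_eq] at h0
  have h2 : w = 0 := le_antisymm (ENNReal.ofReal_eq_zero.1 h0) hw0
  rwa [h2] at hw

end ProductMixtures

/-! ### Divergences of likelihoods -/

section Likelihood

variable {Y : Type*} [MeasureSpace Y] {f g : Y → ℝ}

theorem pdfMeasure_eq_withDensity_div (hfm : Measurable f) (hgm : Measurable g)
    (hf : ∀ y, 0 ≤ f y) (hg : ∀ y, 0 ≤ g y) (hfg : ∀ y, 0 < f y → 0 < g y) :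
    pdfMeasure f = (pdfMeasure g).withDensity fun y => ENNReal.ofReal (f y / g y) := by
  have hm : Measurable fun y => ENNReal.ofReal (f y / g y) := (hfm.div hgm).ennreal_ofReal
  rw [pdfMeasure, pdfMeasure, ← withDensity_mul _ hgm.ennreal_ofReal hm]
  congr 1
  ext y
  rw [Pi.mul_apply, ← ENNReal.ofReal_mul (hg y)]
  rcases (hf y).eq_or_lt with h | h
  · simp [← h]
  · rw [mul_div_cancel₀ _ (hfg y h).ne']

theorem ae_pos_pdfMeasure (hfm : Measurable f) : ∀ᵐ y ∂pdfMeasure f, 0 < f y := by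
  rw [pdfMeasure, ae_withDensity_iff hfm.ennreal_ofReal]
  exact ae_of_all _ fun y hy => by simpa using hy

theorem absolutelyContinuous_of_pos_imp (hfm : Measurable f) (hgm : Measurable g)
    (hf : IsPdf f) (hg : IsPdf g) (hfg : ∀ y, 0 < f y → 0 < g y) :
    pdfMeasure f ≪ pdfMeasure g := by
  rw [pdfMeasure_eq_withDensity_div hfm hgm hf.2.2 hg.2.2 hfg]
  exact withDensity_absolutelyContinuous _ _

theorem rnDeriv_pdfMeasure (hfm : Measurable f) (hgm : Measurable g)
    (hf : IsPdf f) (hg : IsPdf g) (hfg : ∀ y, 0 < f y → 0 < g y) :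
    (pdfMeasure f).rnDeriv (pdfMeasure g)
      =ᵐ[pdfMeasure g] fun y => ENNReal.ofReal (f y / g y) := by
  have := hg.isProbabilityMeasure
  rw [pdfMeasure_eq_withDensity_div hfm hgm hf.2.2 hg.2.2 hfg]
  exact Measure.rnDeriv_withDensity _ (hfm.div hgm).ennreal_ofReal

theorem KL_eq_lintegral (hfm : Measurable f) (hgm : Measurable g)
    (hf : IsPdf f) (hg : IsPdf g) (hfg : ∀ y, 0 < f y → 0 < g y) :
    KL f g = ∫⁻ y, ENNReal.ofReal (g y) *
      ENNReal.ofReal (InformationTheory.klFun (f y / g y)) := by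
  have := hf.isProbabilityMeasure
  have := hg.isProbabilityMeasure
  rw [KL, InformationTheory.klDiv_eq_lintegral_klFun_of_ac
    (absolutelyContinuous_of_pos_imp hfm hgm hf hg hfg)]
  have h1 : ∫⁻ y, ENNReal.ofReal (InformationTheory.klFun
      (((pdfMeasure f).rnDeriv (pdfMeasure g)) y).toReal) ∂pdfMeasure g
      = ∫⁻ y, ENNReal.ofReal (InformationTheory.klFun (f y / g y)) ∂pdfMeasure g := by
    refine lintegral_congr_ae ?_
    filter_upwards [rnDeriv_pdfMeasure hfm hgm hf hg hfg] with y hy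
    rw [hy, ENNReal.toReal_ofReal (div_nonneg (hf.2.2 y) (hg.2.2 y))]
  rw [h1]
  exact lintegral_pdfMeasure hg.1 _
    (InformationTheory.measurable_klFun.comp (hfm.div hgm)).ennreal_ofReal.aemeasurable

theorem llr_pdfMeasure (hfm : Measurable f) (hgm : Measurable g)
    (hf : IsPdf f) (hg : IsPdf g) (hfg : ∀ y, 0 < f y → 0 < g y) :
    llr (pdfMeasure f) (pdfMeasure g)
      =ᵐ[pdfMeasure f] fun y => -(Real.log (g y) - Real.log (f y)) := by
  filter_upwards [(absolutelyContinuous_of_pos_imp hfm hgm hf hg hfg).ae_le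
    (rnDeriv_pdfMeasure hfm hgm hf hg hfg), ae_pos_pdfMeasure hfm] with y hy hy0
  rw [llr, hy, ENNReal.toReal_ofReal (div_nonneg (hf.2.2 y) (hg.2.2 y)),
    Real.log_div hy0.ne' (hfg y hy0).ne']
  ring

theorem ae_log_sub_log_mem_Icc (hfm : Measurable f) {L : ℝ}
    (hLf : ∀ y, 0 < f y → |Real.log (f y)| ≤ L) (hLg : ∀ y, 0 < f y → |Real.log (g y)| ≤ L) :
    ∀ᵐ y ∂pdfMeasure f, Real.log (g y) - Real.log (f y) ∈ Set.Icc (-(2 * L)) (2 * L) := by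
  filter_upwards [ae_pos_pdfMeasure hfm] with y hy
  have h1 := abs_le.1 (hLf y hy)
  have h2 := abs_le.1 (hLg y hy)
  constructor <;> linarith

theorem KL_ne_top (hfm : Measurable f) (hgm : Measurable g)
    (hf : IsPdf f) (hg : IsPdf g) {L : ℝ} (hfg : ∀ y, 0 < f y → 0 < g y)
    (hLf : ∀ y, 0 < f y → |Real.log (f y)| ≤ L) (hLg : ∀ y, 0 < f y → |Real.log (g y)| ≤ L) :
    KL f g ≠ ⊤ := by
  have := hf.isProbabilityMeasure
  refine InformationTheory.klDiv_ne_top (absolutelyContinuous_of_pos_imp hfm hgm hf hg hfg)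
    (Integrable.congr ?_ (llr_pdfMeasure hfm hgm hf hg hfg).symm)
  refine (Integrable.of_bound (hgm.log.sub hfm.log).aestronglyMeasurable (2 * L) ?_).neg
  filter_upwards [ae_log_sub_log_mem_Icc hfm hLf hLg] with y hy
  exact abs_le.2 hy

theorem toReal_KL_eq_integral (hfm : Measurable f) (hgm : Measurable g)
    (hf : IsPdf f) (hg : IsPdf g) (hfg : ∀ y, 0 < f y → 0 < g y) :
    (KL f g).toReal = -∫ y, (Real.log (g y) - Real.log (f y)) ∂pdfMeasure f := by
  have := hf.isProbabilityMeasure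
  have := hg.isProbabilityMeasure
  have hac := absolutelyContinuous_of_pos_imp hfm hgm hf hg hfg
  rw [KL, InformationTheory.toReal_klDiv_of_measure_eq hac (by simp), ← integral_neg]
  exact integral_congr_ae (llr_pdfMeasure hfm hgm hf hg hfg)

/-- Hoeffding's lemma for the tempered likelihood ratio. -/
theorem integral_exp_mul_log_sub_le (hfm : Measurable f) (hgm : Measurable g)
    (hf : IsPdf f) (hg : IsPdf g) {L : ℝ} (hfg : ∀ y, 0 < f y → 0 < g y)
    (hLf : ∀ y, 0 < f y → |Real.log (f y)| ≤ L) (hLg : ∀ y, 0 < f y → |Real.log (g y)| ≤ L)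
    (a : ℝ) :
    ∫ y, Real.exp (a * (Real.log (g y) - Real.log (f y))) ∂pdfMeasure f
      ≤ Real.exp (-(a * (KL f g).toReal) + 2 * L ^ 2 * a ^ 2) := by
  have := hf.isProbabilityMeasure
  have hm : Measurable fun y => Real.log (g y) - Real.log (f y) := hgm.log.sub hfm.log
  have hmem : ∀ᵐ y ∂pdfMeasure f,
      Real.log (g y) - Real.log (f y) ∈ Set.Icc (-(2 * L)) (2 * L) :=
    ae_log_sub_log_mem_Icc hfm hLf hLg
  have h := (hasSubgaussianMGF_of_mem_Icc hm.aemeasurable hmem).mgf_le a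
  rw [toReal_KL_eq_integral hfm hgm hf hg hfg]
  set m := ∫ y, (Real.log (g y) - Real.log (f y)) ∂pdfMeasure f with hmdef
  have h2 : ∫ y, Real.exp (a * (Real.log (g y) - Real.log (f y))) ∂pdfMeasure f
      = Real.exp (a * m) * mgf (fun y => Real.log (g y) - Real.log (f y) - m) (pdfMeasure f) a := by
    rw [mgf, ← integral_const_mul]
    refine integral_congr_ae (ae_of_all _ fun y => ?_)
    simp only
    rw [← Real.exp_add]
    ring_nf
  rw [h2]
  calc _ ≤ Real.exp (a * m) * _ := mul_le_mul_of_nonneg_left h (Real.exp_pos _).le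
    _ = _ := by
      rw [← Real.exp_add]
      congr 1
      have : ‖2 * L - -(2 * L)‖ ^ 2 = (4 * L) ^ 2 := by
        rw [Real.norm_eq_abs, sq_abs]
        ring
      push_cast
      rw [div_pow, this]
      ring

/-- The divergence from a fixed likelihood is measurable in the parameter. -/
theorem measurable_KL {E : Type*} [MeasurableSpace E] [SFinite (volume : Measure Y)]
    {q : Y → E → ℝ} (hq : Measurable (Function.uncurry q)) (hpdf : ∀ x, IsPdf fun y => q y x)
    {x' : E} (hpos : ∀ y, 0 < q y x' → ∀ x, 0 < q y x) :
    Measurable fun x => KL (fun y => q y x') (fun y => q y x) := by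
  have hqx : ∀ x, Measurable fun y => q y x := fun x => hq.comp measurable_prodMk_right
  have h1 : (fun x => KL (fun y => q y x') (fun y => q y x)) = fun x => ∫⁻ y,
      ENNReal.ofReal (q y x) * ENNReal.ofReal (InformationTheory.klFun (q y x' / q y x)) := by
    ext x
    exact KL_eq_lintegral (hqx x') (hqx x) (hpdf x') (hpdf x) fun y hy => hpos y hy x
  rw [h1]
  refine Measurable.lintegral_prod_left' (f := fun a : Y × E => ENNReal.ofReal (q a.1 a.2) *
    ENNReal.ofReal (InformationTheory.klFun (q a.1 x' / q a.1 a.2))) ?_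
  exact hq.ennreal_ofReal.mul (InformationTheory.measurable_klFun.comp
    (((hqx x').comp measurable_fst).div hq)).ennreal_ofReal

theorem KL_eq_zero_iff (hf : IsPdf f) (hg : IsPdf g) : KL f g = 0 ↔ f =ᵐ[volume] g := by
  have := hf.isProbabilityMeasure
  have := hg.isProbabilityMeasure
  rw [KL, InformationTheory.klDiv_eq_zero_iff]
  exact ⟨ae_eq_of_pdfMeasure_eq hf.1 hf.2.2 hg.1 hg.2.2, pdfMeasure_congr⟩

end Likelihood

/-! ### The optimal set -/

section Optimal

variable {n m : ℕ} {d : Fin m → ℕ} {ℓ : Fin n → ℕ} {S : Fin n → Finset (Fin m)}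
  {q : (i : Fin n) → (Fin (ℓ i) → ℝ) → Vars d (S i) → ℝ} {Xstar : Vars d Finset.univ}

theorem isPdf_jointLikelihood (hpdf : ∀ i x, IsPdf (fun z => q i z x))
    (X : Vars d Finset.univ) : IsPdf (jointLikelihood q X) := by
  refine ⟨Integrable.fintype_prod_dep
    (f := fun i z => q i z (restrictVars (Finset.subset_univ (S i)) X))
    fun i => (hpdf i _).1, ?_, fun z => Finset.prod_nonneg fun i _ => (hpdf i _).2.2 _⟩
  have h := integral_fintype_prod_volume_eq_prod
    (fun i z => q i z (restrictVars (Finset.subset_univ (S i)) X))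
  unfold jointLikelihood
  rw [h]
  exact Finset.prod_eq_one fun i _ => (hpdf i _).2.1

/-- Two product densities agree only if all the factors do: the other factors integrate to one. -/
theorem ae_eq_of_jointLikelihood_ae_eq (hpdf : ∀ i x, IsPdf (fun z => q i z x))
    {X X' : Vars d Finset.univ} (h : jointLikelihood q X =ᵐ[volume] jointLikelihood q X')
    (i : Fin n) :
    (fun z => q i z (restrictVars (Finset.subset_univ (S i)) X))
      =ᵐ[volume] fun z => q i z (restrictVars (Finset.subset_univ (S i)) X') := by
  have key : ∀ (X : Vars d Finset.univ) (B : Set (Fin (ℓ i) → ℝ)), MeasurableSet B →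
      ∫ z in {z | z i ∈ B}, jointLikelihood q X z
        = ∫ y in B, q i y (restrictVars (Finset.subset_univ (S i)) X) := fun X B hB => by
    have hpre : MeasurableSet {z : (i : Fin n) → Fin (ℓ i) → ℝ | z i ∈ B} :=
      measurable_pi_apply i hB
    rw [← integral_indicator hpre, ← integral_indicator hB]
    let F : (j : Fin n) → (Fin (ℓ j) → ℝ) → ℝ := fun j y =>
      if h : j = i then B.indicator (fun _ => 1) (h ▸ y) *
        q j y (restrictVars (Finset.subset_univ (S j)) X)
      else q j y (restrictVars (Finset.subset_univ (S j)) X)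
    have h1 : ({z : (i : Fin n) → Fin (ℓ i) → ℝ | z i ∈ B}.indicator fun z =>
        jointLikelihood q X z) = fun z => ∏ j, F j (z j) := by
      ext z
      rw [← Finset.mul_prod_erase _ _ (Finset.mem_univ i)]
      have h2 : ∏ j ∈ Finset.univ.erase i, F j (z j) = ∏ j ∈ Finset.univ.erase i,
          q j (z j) (restrictVars (Finset.subset_univ (S j)) X) :=
        Finset.prod_congr rfl fun j hj => by simp [F, Finset.ne_of_mem_erase hj]
      rw [h2]
      by_cases hz : z i ∈ B
      · rw [Set.indicator_of_mem (by exact hz), jointLikelihood,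
          ← Finset.mul_prod_erase _ _ (Finset.mem_univ i)]
        simp [F, hz]
      · rw [Set.indicator_of_notMem (by exact hz)]
        simp [F, hz]
    rw [h1, integral_fintype_prod_volume_eq_prod,
      ← Finset.mul_prod_erase _ _ (Finset.mem_univ i),
      Finset.prod_eq_one fun j hj => ?_, mul_one]
    · congr 1
      ext y
      by_cases hy : y ∈ B <;> simp [F, hy]
    · simp only [F, Finset.ne_of_mem_erase hj, dite_false]
      exact (hpdf j _).2.1
  refine Integrable.ae_eq_of_forall_setIntegral_eq _ _ (hpdf i _).1 (hpdf i _).1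
    fun B hB _ => ?_
  rw [← key X B hB, ← key X' B hB]
  exact integral_congr_ae (ae_restrict_of_ae h)

theorem jointLikelihood_ae_eq {X X' : Vars d Finset.univ}
    (h : ∀ i, (fun z => q i z (restrictVars (Finset.subset_univ (S i)) X))
      =ᵐ[volume] fun z => q i z (restrictVars (Finset.subset_univ (S i)) X')) :
    jointLikelihood q X =ᵐ[volume] jointLikelihood q X' := by
  have h1 : ∀ᵐ z : (i : Fin n) → Fin (ℓ i) → ℝ, ∀ i,
      q i (z i) (restrictVars (Finset.subset_univ (S i)) X)
        = q i (z i) (restrictVars (Finset.subset_univ (S i)) X') :=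
    ae_all_iff.2 fun i => (Measure.quasiMeasurePreserving_eval
      (fun i => (volume : Measure (Fin (ℓ i) → ℝ))) i).ae (h i)
  filter_upwards [h1] with z hz
  exact Finset.prod_congr rfl fun i _ => hz i

/-- The parameters of agent `i` that it cannot distinguish from the true ones. -/
def indistinguishable (q : (i : Fin n) → (Fin (ℓ i) → ℝ) → Vars d (S i) → ℝ)
    (Xstar : Vars d Finset.univ) (i : Fin n) : Set (Vars d (S i)) :=
  {x | KL (fun z => q i z (restrictVars (Finset.subset_univ (S i)) Xstar)) (fun z => q i z x) = 0}

theorem KL_jointLikelihood_eq_zero_iff (hpdf : ∀ i x, IsPdf (fun z => q i z x))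
    (X : Vars d Finset.univ) :
    KL (jointLikelihood q Xstar) (jointLikelihood q X) = 0
      ↔ ∀ i, restrictVars (Finset.subset_univ (S i)) X ∈ indistinguishable q Xstar i := by
  rw [KL_eq_zero_iff (isPdf_jointLikelihood hpdf _) (isPdf_jointLikelihood hpdf _)]
  have h2 : ∀ i, restrictVars (Finset.subset_univ (S i)) X ∈ indistinguishable q Xstar i ↔
      (fun z => q i z (restrictVars (Finset.subset_univ (S i)) Xstar))
        =ᵐ[volume] fun z => q i z (restrictVars (Finset.subset_univ (S i)) X) := fun i =>
    KL_eq_zero_iff (hpdf i _) (hpdf i _)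
  simp only [h2]
  exact ⟨ae_eq_of_jointLikelihood_ae_eq hpdf, jointLikelihood_ae_eq⟩

/-- A density that vanishes off the parameters that no agent distinguishes from the true ones is
optimal. -/
theorem mem_optimalSet (hpdf : ∀ i x, IsPdf (fun z => q i z x)) {r : Vars d Finset.univ → ℝ}
    (hr : IsPdf r)
    (h0 : ∀ X, (∃ i, restrictVars (Finset.subset_univ (S i)) X ∉ indistinguishable q Xstar i) →
      r X = 0) : r ∈ optimalSet q Xstar := by
  refine ⟨hr, fun p' _ => ?_⟩
  have : objective q Xstar r = 0 := by
    unfold objective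
    refine (lintegral_congr_ae ?_).trans lintegral_zero
    rw [pdfMeasure, EventuallyEq, ae_withDensity_iff' (aemeasurable_ofReal hr.1)]
    refine ae_of_all _ fun X hX => (KL_jointLikelihood_eq_zero_iff hpdf X).2 fun i => ?_
    by_contra hi
    exact hX (by rw [h0 X ⟨i, hi⟩, ENNReal.ofReal_zero])
  rw [this]
  exact zero_le

theorem ae_indistinguishable_of_objective_eq_zero
    (hq_meas : ∀ i, Measurable (Function.uncurry (q i)))
    (hpdf : ∀ i x, IsPdf (fun z => q i z x))
    (hpos : ∀ i y, 0 < q i y (restrictVars (Finset.subset_univ (S i)) Xstar) →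
      ∀ x, 0 < q i y x) {r : Vars d Finset.univ → ℝ} (hr : objective q Xstar r = 0) :
    ∀ᵐ X ∂pdfMeasure r, ∀ i,
      restrictVars (Finset.subset_univ (S i)) X ∈ indistinguishable q Xstar i := by
  have hm : Measurable fun X => KL (jointLikelihood q Xstar) (jointLikelihood q X) := by
    refine measurable_KL (q := fun z X => jointLikelihood q X z) ?_
      (fun X => isPdf_jointLikelihood hpdf X) fun z hz X => ?_
    · have h1 : ∀ i, Measurable fun a : ((i : Fin n) → Fin (ℓ i) → ℝ) × Vars d Finset.univ =>
          q i (a.1 i) (restrictVars (Finset.subset_univ (S i)) a.2) := fun i => by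
        have h2 : Measurable fun a : ((i : Fin n) → Fin (ℓ i) → ℝ) × Vars d Finset.univ =>
            (a.1 i, restrictVars (Finset.subset_univ (S i)) a.2) := by fun_prop
        exact (hq_meas i).comp h2
      have h3 : Measurable fun a : ((i : Fin n) → Fin (ℓ i) → ℝ) × Vars d Finset.univ =>
          jointLikelihood q a.2 a.1 := Finset.measurable_fun_prod _ fun i _ => h1 i
      exact h3
    · refine Finset.prod_pos fun i _ => hpos i _ ?_ _
      refine lt_of_le_of_ne ((hpdf i _).2.2 _) fun h => hz.ne' ?_
      exact Finset.prod_eq_zero (Finset.mem_univ i) h.symm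
  rw [objective, lintegral_eq_zero_iff hm] at hr
  exact hr.mono fun X hX => (KL_jointLikelihood_eq_zero_iff hpdf X).1 hX

theorem measurableSet_indistinguishable (hq_meas : ∀ i, Measurable (Function.uncurry (q i)))
    (hpdf : ∀ i x, IsPdf (fun z => q i z x))
    (hpos : ∀ i y, 0 < q i y (restrictVars (Finset.subset_univ (S i)) Xstar) →
      ∀ x, 0 < q i y x) (i : Fin n) : MeasurableSet (indistinguishable q Xstar i) :=
  measurable_KL (hq_meas i) (hpdf i) (hpos i) (measurableSet_singleton 0)

end Optimal

/-! ### The tempered posterior of a single agent -/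

section SingleAgent

variable {Y E Ω : Type*} [MeasureSpace Y] [MeasurableSpace Ω] {P : Measure Ω}
  {Z : ℕ → Ω → Y} {α : ℕ → ℝ} {L : ℝ}

theorem ae_pos_likelihood [MeasurableSpace E] {q : Y → E → ℝ}
    (hq : Measurable (Function.uncurry q)) {x' : E} (hZ : ∀ s, Measurable (Z s))
    (hlaw : ∀ s, P.map (Z s) = pdfMeasure fun y => q y x') :
    ∀ᵐ ω ∂P, ∀ s, 0 < q (Z s ω) x' := by
  refine ae_all_iff.2 fun s => ae_of_ae_map (p := fun y => 0 < q y x') (hZ s).aemeasurable ?_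
  rw [hlaw s]
  exact ae_pos_pdfMeasure (hq.comp measurable_prodMk_right)

/-- Parameters with the same likelihood as `x'` have likelihood ratio one. -/
theorem ae_likelihoodRatio_eq_one [IsProbabilityMeasure P] [MeasurableSpace E] {q : Y → E → ℝ}
    (hq : Measurable (Function.uncurry q)) (hpdf : ∀ x, IsPdf fun y => q y x) {x' : E}
    (hZ : ∀ s, Measurable (Z s)) (hlaw : ∀ s, P.map (Z s) = pdfMeasure fun y => q y x')
    (ν : Measure E) [SFinite ν]
    (hν : ∀ᵐ x ∂ν, KL (fun y => q y x') (fun y => q y x) = 0) :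
    ∀ᵐ ω ∂P, ∀ᵐ x ∂ν, ∀ t, likelihoodRatio q α x' (fun s => Z s ω) t x = 1 := by
  have h1 : ∀ᵐ x ∂ν, ∀ᵐ ω ∂P, ∀ s, q (Z s ω) x = q (Z s ω) x' := by
    filter_upwards [hν] with x hx
    refine ae_all_iff.2 fun s =>
      ae_of_ae_map (p := fun y => q y x = q y x') (hZ s).aemeasurable ?_
    rw [hlaw s]
    exact pdfMeasure_absolutelyContinuous.ae_le
      (((KL_eq_zero_iff (hpdf x') (hpdf x)).1 hx).mono fun y hy => hy.symm)
  have hm : MeasurableSet {a : E × Ω | ∀ s, q (Z s a.2) a.1 = q (Z s a.2) x'} := by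
    have h2 : {a : E × Ω | ∀ s, q (Z s a.2) a.1 = q (Z s a.2) x'}
        = ⋂ s, {a : E × Ω | q (Z s a.2) a.1 = q (Z s a.2) x'} := by
      ext; simp
    rw [h2]
    refine MeasurableSet.iInter fun s => measurableSet_eq_fun
      (hq.comp (((hZ s).comp measurable_snd).prodMk measurable_fst))
      ((hq.comp measurable_prodMk_right).comp ((hZ s).comp measurable_snd))
  rw [Measure.ae_ae_comm hm] at h1
  filter_upwards [h1] with ω hω
  filter_upwards [hω] with x hx t
  simp [likelihoodRatio, hx]

/-- The factor of the likelihood ratio, damped by the variance term of Hoeffding's lemma so that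
its mean is at most one. -/
noncomputable def dampedFactor {Y E : Type*} (q : Y → E → ℝ) (x' : E) (L a : ℝ) (y : Y) (x : E) :
    ℝ≥0∞ :=
  ENNReal.ofReal (Real.exp (a * (Real.log (q y x) - Real.log (q y x')) - 2 * L ^ 2 * a ^ 2))

theorem measurable_dampedFactor [MeasurableSpace E] {q : Y → E → ℝ}
    (hq : Measurable (Function.uncurry q)) (x' : E) (L a : ℝ) :
    Measurable (Function.uncurry (dampedFactor q x' L a)) := by
  have h1 : Measurable fun y => Real.log (q y x') := (hq.comp measurable_prodMk_right).log
  have h2 : Measurable fun b : Y × E => Real.log (q b.1 b.2) := hq.log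
  exact (((h2.sub (h1.comp measurable_fst)).const_mul a).sub_const _).exp.ennreal_ofReal

theorem lintegral_dampedFactor_le [MeasurableSpace E] {q : Y → E → ℝ}
    (hq : Measurable (Function.uncurry q)) (hpdf : ∀ x, IsPdf fun y => q y x) {x' : E}
    (hL : ∀ y, 0 < q y x' → ∀ x, 0 < q y x ∧ |Real.log (q y x)| ≤ L)
    (hZ : ∀ s, Measurable (Z s)) (hlaw : ∀ s, P.map (Z s) = pdfMeasure fun y => q y x')
    (a : ℝ) (s : ℕ) (x : E) :
    ∫⁻ ω, dampedFactor q x' L a (Z s ω) x ∂P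
      ≤ ENNReal.ofReal (Real.exp (-(a * (KL (fun y => q y x') (fun y => q y x)).toReal))) := by
  have hqx : ∀ x, Measurable fun y => q y x := fun x => hq.comp measurable_prodMk_right
  have := (hpdf x').isProbabilityMeasure
  have hm : Measurable fun y => dampedFactor q x' L a y x :=
    (measurable_dampedFactor hq x' L a).comp measurable_prodMk_right
  have hm' : Measurable fun y => Real.exp (a * (Real.log (q y x) - Real.log (q y x'))) :=
    (((hqx x).log.sub (hqx x').log).const_mul a).exp
  have hint : Integrable (fun y => Real.exp (a * (Real.log (q y x) - Real.log (q y x'))))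
      (pdfMeasure fun y => q y x') := by
    refine Integrable.of_bound hm'.aestronglyMeasurable (Real.exp (|a| * (2 * L))) ?_
    filter_upwards [ae_log_sub_log_mem_Icc (hqx x') (fun y hy => (hL y hy x').2)
      (fun y hy => (hL y hy x).2)] with y hy
    rw [Real.norm_of_nonneg (Real.exp_pos _).le, Real.exp_le_exp]
    refine (le_abs_self _).trans ?_
    rw [abs_mul]
    exact mul_le_mul_of_nonneg_left (abs_le.2 hy) (abs_nonneg _)
  rw [← lintegral_map (f := fun y => dampedFactor q x' L a y x) hm (hZ s), hlaw s]
  unfold dampedFactor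
  simp_rw [Real.exp_sub _ (2 * L ^ 2 * a ^ 2)]
  rw [← ofReal_integral_eq_lintegral_ofReal (hint.div_const _) (ae_of_all _ fun y => by positivity),
    integral_div]
  refine ENNReal.ofReal_le_ofReal ?_
  rw [div_le_iff₀ (Real.exp_pos _), ← Real.exp_add]
  exact integral_exp_mul_log_sub_le (hqx x') (hqx x) (hpdf x') (hpdf x)
    (fun y hy => (hL y hy x).1) (fun y hy => (hL y hy x').2) (fun y hy => (hL y hy x).2) a

theorem prod_dampedFactor {Y E : Type*} (q : Y → E → ℝ) (α : ℕ → ℝ) (x' : E) (L : ℝ)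
    (z : ℕ → Y) (t : ℕ) (x : E) :
    ∏ s ∈ Finset.range t, dampedFactor q x' L (α s) (z s) x
      = ENNReal.ofReal (Real.exp (-(2 * L ^ 2 * ∑ s ∈ Finset.range t, α s ^ 2))) *
        ENNReal.ofReal (likelihoodRatio q α x' z t x) := by
  rw [← ENNReal.ofReal_mul (Real.exp_pos _).le]
  unfold dampedFactor likelihoodRatio
  rw [← ENNReal.ofReal_prod_of_nonneg fun s _ => (Real.exp_pos _).le]
  congr 1
  simp_rw [Real.exp_sub _ (2 * L ^ 2 * _)]
  rw [Finset.prod_div_distrib, ← Real.exp_sum (f := fun s => 2 * L ^ 2 * α s ^ 2),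
    ← Finset.mul_sum, Real.exp_neg, div_eq_inv_mul]

/-- The mixture of the likelihood ratios over a finite measure is almost surely bounded in time,
and it tends to zero if the measure charges only parameters that the likelihood distinguishes
from `x'`. -/
theorem ae_lintegral_likelihoodRatio [IsProbabilityMeasure P] [MeasurableSpace E] {q : Y → E → ℝ}
    (hq : Measurable (Function.uncurry q)) (hpdf : ∀ x, IsPdf fun y => q y x) {x' : E}
    (hL : ∀ y, 0 < q y x' → ∀ x, 0 < q y x ∧ |Real.log (q y x)| ≤ L)
    (hZ : ∀ s, Measurable (Z s)) (hlaw : ∀ s, P.map (Z s) = pdfMeasure fun y => q y x')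
    (hind : iIndepFun Z P) (hα : ∀ t, 0 < α t) (hsum : ¬Summable α)
    (hsq : Summable fun t => α t ^ 2) (μ : Measure E) [IsFiniteMeasure μ] :
    ∀ᵐ ω ∂P,
      (∀ t, ∫⁻ x, ENNReal.ofReal (likelihoodRatio q α x' (fun s => Z s ω) t x) ∂μ ≠ ⊤) ∧
      (∃ M : ℝ, ∀ t,
        (∫⁻ x, ENNReal.ofReal (likelihoodRatio q α x' (fun s => Z s ω) t x) ∂μ).toReal ≤ M) ∧
      ((∀ᵐ x ∂μ, KL (fun y => q y x') (fun y => q y x) ≠ 0) → Tendsto (fun t =>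
        (∫⁻ x, ENNReal.ofReal (likelihoodRatio q α x' (fun s => Z s ω) t x) ∂μ).toReal)
        atTop (𝓝 0)) := by
  have hg : ∀ s, Measurable (Function.uncurry (dampedFactor q x' L (α s))) := fun s =>
    measurable_dampedFactor hq x' L (α s)
  have hmean := fun s x => lintegral_dampedFactor_le hq hpdf hL hZ hlaw (α s) s x
  have hone : ∀ s x, ∫⁻ ω, dampedFactor q x' L (α s) (Z s ω) x ∂P ≤ 1 := fun s x => by
    refine (hmean s x).trans ?_
    rw [← ENNReal.ofReal_one]
    refine ENNReal.ofReal_le_ofReal (Real.exp_le_one_iff.2 ?_)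
    exact neg_nonpos.2 (mul_nonneg (hα s).le ENNReal.toReal_nonneg)
  -- the damping is bounded away from zero because the squares of the steps are summable
  set κ := Real.exp (2 * L ^ 2 * ∑' s, α s ^ 2) with hκ
  have hle : ∀ (z : ℕ → Y) t, ∫⁻ x, ENNReal.ofReal (likelihoodRatio q α x' z t x) ∂μ
      ≤ ENNReal.ofReal κ *
        ∫⁻ x, ∏ s ∈ Finset.range t, dampedFactor q x' L (α s) (z s) x ∂μ := fun z t => by
    rw [← lintegral_const_mul' _ _ ENNReal.ofReal_ne_top]
    refine lintegral_mono fun x => ?_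
    rw [prod_dampedFactor, ← mul_assoc, ← ENNReal.ofReal_mul (Real.exp_pos _).le]
    refine le_mul_of_one_le_left' ?_
    rw [← ENNReal.ofReal_one]
    refine ENNReal.ofReal_le_ofReal ?_
    rw [← Real.exp_add]
    refine Real.one_le_exp ?_
    have := hsq.sum_le_tsum (Finset.range t) fun s _ => sq_nonneg (α s)
    have := mul_le_mul_of_nonneg_left this (by positivity : 0 ≤ 2 * L ^ 2)
    linarith
  have hzero : (∀ᵐ x ∂μ, KL (fun y => q y x') (fun y => q y x) ≠ 0) →
      ∀ᵐ x ∂μ, Tendsto (fun t => ∏ s ∈ Finset.range t,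
        ∫⁻ ω, dampedFactor q x' L (α s) (Z s ω) x ∂P) atTop (𝓝 0) := fun hμ => by
    filter_upwards [hμ] with x hx
    have hqx : ∀ x, Measurable fun y => q y x := fun x => hq.comp measurable_prodMk_right
    have hK : 0 < (KL (fun y => q y x') (fun y => q y x)).toReal :=
      ENNReal.toReal_pos hx (KL_ne_top (hqx x') (hqx x) (hpdf x') (hpdf x)
        (fun y hy => (hL y hy x).1) (fun y hy => (hL y hy x').2) (fun y hy => (hL y hy x).2))
    have hdiv := (not_summable_iff_tendsto_nat_atTop_of_nonneg fun t => (hα t).le).1 hsum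
    have hexp := ENNReal.tendsto_ofReal
      (Real.tendsto_exp_neg_atTop_nhds_zero.comp (hdiv.atTop_mul_const hK))
    rw [ENNReal.ofReal_zero] at hexp
    refine tendsto_of_tendsto_of_tendsto_of_le_of_le tendsto_const_nhds hexp
      (fun t => zero_le) fun t => ?_
    refine (Finset.prod_le_prod' fun s _ => hmean s x).trans_eq ?_
    rw [← ENNReal.ofReal_prod_of_nonneg fun s _ => (Real.exp_pos _).le, ← Real.exp_sum,
      Finset.sum_neg_distrib, ← Finset.sum_mul]
    rfl
  have hzero' : ∀ᵐ ω ∂P, (∀ᵐ x ∂μ, KL (fun y => q y x') (fun y => q y x) ≠ 0) →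
      Tendsto (fun t => (∫⁻ x, ∏ s ∈ Finset.range t,
        dampedFactor q x' L (α s) (Z s ω) x ∂μ).toReal) atTop (𝓝 0) := by
    by_cases hμ : ∀ᵐ x ∂μ, KL (fun y => q y x') (fun y => q y x) ≠ 0
    · filter_upwards [ae_tendsto_zero_lintegral_prod_range hZ hind hg μ hone (hzero hμ)] with ω hω _
      exact hω
    · exact ae_of_all _ fun ω h => absurd h hμ
  filter_upwards [ae_tendsto_lintegral_prod_range hZ hind hg μ hone, hzero'] with ω h1 h2
  obtain ⟨hfin, w, hw⟩ := h1
  have htop : ∀ t, ENNReal.ofReal κ * ∫⁻ x, ∏ s ∈ Finset.range t,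
      dampedFactor q x' L (α s) (Z s ω) x ∂μ ≠ ⊤ := fun t =>
    ENNReal.mul_ne_top ENNReal.ofReal_ne_top (hfin t)
  have hreal : ∀ t,
      (∫⁻ x, ENNReal.ofReal (likelihoodRatio q α x' (fun s => Z s ω) t x) ∂μ).toReal
        ≤ κ * (∫⁻ x, ∏ s ∈ Finset.range t,
          dampedFactor q x' L (α s) (Z s ω) x ∂μ).toReal := fun t => by
    refine (ENNReal.toReal_mono (htop t) (hle _ t)).trans_eq ?_
    rw [ENNReal.toReal_mul, ENNReal.toReal_ofReal (Real.exp_pos _).le]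
  refine ⟨fun t => ne_top_of_le_ne_top (htop t) (hle _ t), ?_, fun hμ => ?_⟩
  · obtain ⟨M, hM⟩ := hw.bddAbove_range
    refine ⟨κ * M, fun t => (hreal t).trans ?_⟩
    exact mul_le_mul_of_nonneg_left (hM ⟨t, rfl⟩) (Real.exp_pos _).le
  · refine squeeze_zero (fun t => ENNReal.toReal_nonneg) hreal ?_
    simpa using (h2 hμ).const_mul κ

variable [MeasureSpace E]

/-- The prior, reweighted by the likelihood ratios, has bounded mass and forgets the parameters
that the likelihood distinguishes from `x'`. -/
theorem ae_integral_mul_likelihoodRatio [IsProbabilityMeasure P] {q : Y → E → ℝ}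
    [SFinite (volume : Measure Y)]
    (hq : Measurable (Function.uncurry q)) (hpdf : ∀ x, IsPdf fun y => q y x) {x' : E}
    (hL : ∀ y, 0 < q y x' → ∀ x, 0 < q y x ∧ |Real.log (q y x)| ≤ L)
    (hZ : ∀ s, Measurable (Z s)) (hlaw : ∀ s, P.map (Z s) = pdfMeasure fun y => q y x')
    (hind : iIndepFun Z P) (hα : ∀ t, 0 < α t) (hsum : ¬Summable α)
    (hsq : Summable fun t => α t ^ 2) {p0 : E → ℝ} (hp0 : IsPdf p0) :
    ∀ᵐ ω ∂P,
      (∀ t, Integrable fun x => p0 x * likelihoodRatio q α x' (fun s => Z s ω) t x) ∧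
      (∃ M : ℝ, ∀ t, ∫ x, p0 x * likelihoodRatio q α x' (fun s => Z s ω) t x ≤ M) ∧
      Tendsto (fun t => ∫ x in {x | KL (fun y => q y x') (fun y => q y x) = 0}ᶜ,
        p0 x * likelihoodRatio q α x' (fun s => Z s ω) t x) atTop (𝓝 0) := by
  have := hp0.isProbabilityMeasure
  set Θ : Set E := {x | KL (fun y => q y x') (fun y => q y x) = 0} with hΘ
  have hΘm : MeasurableSet Θ :=
    measurable_KL hq hpdf (fun y hy x => (hL y hy x).1) (measurableSet_singleton 0)
  have hRm : ∀ (z : ℕ → Y) t, Measurable (likelihoodRatio q α x' z t) := fun z t =>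
    Finset.measurable_fun_prod _ fun s _ => ((((hq.comp measurable_prodMk_left).log).sub_const
      (Real.log (q (z s) x'))).const_mul (α s)).exp
  have hset : ∀ (z : ℕ → Y) t (B : Set E), MeasurableSet B →
      ∫ x in B, p0 x * likelihoodRatio q α x' z t x = (∫⁻ x,
        ENNReal.ofReal (likelihoodRatio q α x' z t x) ∂(pdfMeasure p0).restrict B).toReal :=
    fun z t B hB => by
      rw [← integral_eq_lintegral_of_nonneg_ae (ae_of_all _ fun x =>
        (likelihoodRatio_pos q α x' z t x).le) (hRm z t).aestronglyMeasurable, pdfMeasure,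
        setIntegral_withDensity_eq_setIntegral_toReal_smul₀
          (aemeasurable_ofReal hp0.1).restrict (ae_of_all _ fun _ => ENNReal.ofReal_lt_top) _ hB]
      simp only [ENNReal.toReal_ofReal (hp0.2.2 _), smul_eq_mul]
  filter_upwards [ae_lintegral_likelihoodRatio hq hpdf hL hZ hlaw hind hα hsum hsq
      ((pdfMeasure p0).restrict Set.univ),
    ae_lintegral_likelihoodRatio hq hpdf hL hZ hlaw hind hα hsum hsq
      ((pdfMeasure p0).restrict Θᶜ)] with ω h1 h2
  refine ⟨fun t => ?_, ?_, ?_⟩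
  · rw [← integrable_pdfMeasure_iff hp0.1 hp0.2.2]
    refine ⟨(hRm _ t).aestronglyMeasurable, ?_⟩
    rw [hasFiniteIntegral_iff_ofReal (ae_of_all _ fun x => (likelihoodRatio_pos q α x' _ t x).le)]
    have := (h1.1 t).lt_top
    rwa [Measure.restrict_univ] at this
  · obtain ⟨M, hM⟩ := h1.2.1
    refine ⟨M, fun t => ?_⟩
    rw [← setIntegral_univ, hset _ t _ .univ]
    exact hM t
  · simp only [hset _ _ _ hΘm.compl]
    refine h2.2.2 ?_
    exact ae_restrict_of_forall_mem hΘm.compl fun x hx => hx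

end SingleAgent

end DMSMD

theorem mainTheorem2
    {n m : ℕ} (d : Fin m → ℕ) (ℓ : Fin n → ℕ)
    -- the variables observed by each agent; together they cover all variables
    (S : Fin n → Finset (Fin m)) (hcover : ∀ v, ∃ i, v ∈ S i)
    -- true parameter and likelihoods
    (Xstar : DMSMD.Vars d Finset.univ)
    (q : (i : Fin n) → (Fin (ℓ i) → ℝ) → DMSMD.Vars d (S i) → ℝ)
    (hq_meas : ∀ i, Measurable (Function.uncurry (q i)))
    (hq_pdf : ∀ i x, DMSMD.IsPdf (fun z => q i z x))
    -- independence of the measurements across time and agents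
    {Ω : Type*} [MeasurableSpace Ω] (P : Measure Ω) [IsProbabilityMeasure P]
    (z : ℕ → (i : Fin n) → Ω → Fin (ℓ i) → ℝ)
    (hz_meas : ∀ t i, Measurable (z t i))
    (hz_law : ∀ t i, P.map (z t i) = DMSMD.pdfMeasure
      (fun y => q i y (DMSMD.restrictVars (Finset.subset_univ (S i)) Xstar)))
    (hz_indep : iIndepFun (fun k : ℕ × Fin n => z k.1 k.2) P)
    -- communication graph and weights
    (G : Digraph (Fin n)) (hG_conn : ∀ i j, Relation.ReflTransGen G.Adj i j)
    (A : Matrix (Fin n) (Fin n) ℝ) (hA_nonneg : ∀ i j, 0 ≤ A i j)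
    (hA_graph : ∀ i j, 0 < A i j ↔ G.Adj i j)
    (hA_symm : A.IsSymm) (hA_stoch : A.mulVec 1 = 1) (hA_diag : ∀ i, 0 < A i i)
    -- bounded log-likelihoods on the values that the measurements take
    (L : ℝ)
    (hL : ∀ i y, 0 < q i y (DMSMD.restrictVars (Finset.subset_univ (S i)) Xstar) →
      ∀ x, 0 < q i y x ∧ |Real.log (q i y x)| ≤ L)
    -- step sizes
    (α : ℕ → ℝ) (hα_pos : ∀ t, 0 < α t) (hα_sum : ¬ Summable α)
    (hα_sq : Summable (fun t => α t ^ 2))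
    -- positive priors
    (p0 : (i : Fin n) → DMSMD.Vars d (S i) → ℝ)
    (hp0 : ∀ i, DMSMD.IsPdf (p0 i)) (hp0_pos : ∀ i x, 0 < p0 i x)
    -- the agents that estimate a common variable induce a connected subgraph
    (hmarg : ∀ v i j, v ∈ S i → v ∈ S j →
      Relation.ReflTransGen (fun a b => G.Adj a b ∧ v ∈ S a ∧ v ∈ S b) i j)
    -- the set of optimal pdfs is nonempty, with the optimal value that `Xstar` has
    (hopt : ∃ p ∈ DMSMD.optimalSet q Xstar, DMSMD.objective q Xstar p = 0)
    -- the estimates generated by the algorithm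
    (p : ℕ → (i : Fin n) → Ω → DMSMD.Vars d (S i) → ℝ)
    (hp : ∀ᵐ ω ∂P, DMSMD.IsGenerated A q α p0 (fun t i => z t i ω) (fun t i => p t i ω))
    -- the conjectured total variation contraction of marginal mixing
    (σ c : ℝ) (hσ : 0 < σ ∧ σ < 1) (hc : 1 < c)
    (hconj : ∀ᵐ ω ∂P, DMSMD.MixingContraction A α L σ c (fun t i => p t i ω)) :
    ∀ᵐ ω ∂P, ∀ i, ∀ ε : ℝ, 0 < ε → ∀ᶠ t in atTop,
      DMSMD.mixed A (fun j => p t j ω) i ∈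
        DMSMD.partialNeighborhood (S i) (DMSMD.optimalSet q Xstar) ε := by
  have hA1 : ∀ i, ∑ j, A i j = 1 := fun i => by
    simpa [Matrix.mulVec, dotProduct] using congrFun hA_stoch i
  have hα0 : Tendsto α atTop (𝓝 0) := by
    have h1 := (Real.continuous_sqrt.tendsto 0).comp hα_sq.tendsto_atTop_zero
    simpa [Function.comp_def, Real.sqrt_sq (hα_pos _).le] using h1
  have hpos : ∀ i y, 0 < q i y (DMSMD.restrictVars (Finset.subset_univ (S i)) Xstar) →
      ∀ x, 0 < q i y x := fun i y hy x => (hL i y hy x).1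
  have hind : ∀ i, iIndepFun (fun t => z t i) P := fun i =>
    hz_indep.precomp (g := fun t => (t, i)) fun _ _ h => congrArg Prod.fst h
  obtain ⟨r, hr, hr0⟩ := hopt
  have := hr.1.isProbabilityMeasure
  have hΘ := DMSMD.measurableSet_indistinguishable hq_meas hq_pdf hpos
  have hrΘ := DMSMD.ae_indistinguishable_of_objective_eq_zero hq_meas hq_pdf hpos hr0
  have hzpos : ∀ᵐ ω ∂P, ∀ i t,
      0 < q i (z t i ω) (DMSMD.restrictVars (Finset.subset_univ (S i)) Xstar) :=
    ae_all_iff.2 fun i => DMSMD.ae_pos_likelihood (hq_meas i) (fun t => hz_meas t i)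
      fun t => hz_law t i
  have hone : ∀ᵐ ω ∂P, ∀ i, ∀ᵐ X ∂DMSMD.pdfMeasure r, ∀ t, DMSMD.likelihoodRatio (q i) α
      (DMSMD.restrictVars (Finset.subset_univ (S i)) Xstar) (fun s => z s i ω) t
      (DMSMD.restrictVars (Finset.subset_univ (S i)) X) = 1 := by
    refine ae_all_iff.2 fun i => ?_
    have hres : Measurable (DMSMD.restrictVars (d := d) (Finset.subset_univ (S i))) :=
      DMSMD.measurable_restrictVars _
    have h1 : ∀ᵐ x ∂(DMSMD.pdfMeasure r).map (DMSMD.restrictVars (Finset.subset_univ (S i))),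
        x ∈ DMSMD.indistinguishable q Xstar i :=
      (ae_map_iff hres.aemeasurable (hΘ i)).2 (hrΘ.mono fun X hX => hX i)
    filter_upwards [DMSMD.ae_likelihoodRatio_eq_one (α := α) (hq_meas i) (hq_pdf i)
      (fun t => hz_meas t i) (fun t => hz_law t i) _ h1] with ω hω
    exact ae_of_ae_map hres.aemeasurable hω
  have hpost := ae_all_iff.2 fun i => DMSMD.ae_integral_mul_likelihoodRatio (hq_meas i)
    (hq_pdf i) (hL i) (fun t => hz_meas t i) (fun t => hz_law t i) (hind i) hα_pos hα_sum hα_sq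
    (hp0 i)
  filter_upwards [hp, hconj, hzpos, hone, hpost] with ω hgen hmix hzω honeω hpostω
  obtain ⟨pbar, hpdf, hcontr, hdrift⟩ := hmix
  have hLω : ∀ t i x, |Real.log (q i (z t i ω) x)| ≤ L := fun t i x =>
    (hL i _ (hzω i t) x).2
  have htv := hgen.tendsto_tvDist hq_meas hLω hA_nonneg hA1 hp0 hp0_pos hα0 hσ hpdf hcontr hdrift
  choose hint hbdd hlim using hpostω
  choose M hM using hbdd
  obtain ⟨K, hK⟩ := (Set.finite_range M).bddAbove
  have hpt := hgen.isPdf_and_pos hq_meas hLω hA_nonneg hA1 hp0 hp0_pos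
  intro i ε hε
  refine DMSMD.eventually_mem_partialNeighborhood hΘ
    (fun r' hr' h0 => DMSMD.mem_optimalSet hq_pdf hr' h0)
    (v := fun t => DMSMD.mixed A fun j => p t j ω)
    (fun t => DMSMD.isPdf_mixed hA_nonneg hA1 (hpt t).1 (hpt t).2) hpdf htv (fun j => ?_) i hε
  exact hgen.tendsto_measureReal_mixed hq_meas hLω hA_nonneg hA1 hA_symm hp0 hp0_pos hpdf htv
    (fun j => DMSMD.restrictVars (Finset.subset_univ (S j)) Xstar) hr.1
    ((ae_all_iff.2 honeω).mono fun X hX t j => hX j t) (fun t j => hint j t)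
    (fun t j => (hM j t).trans (hK ⟨j, rfl⟩)) j (hΘ j).compl (hlim j)
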